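/- Let $\mathcal P$ be the set of prime numbers and let $\mathcal U=\{u_i : i\ge 2\}=\{1,2,3,5,8,\dots\}$ be the set of Fibonacci numbers, where $u_1=u_2=1$ and $u_{i+2}=u_{i+1}+u_i$. For a set $\mathcal S$ of positive integers let $\mathcal S(N)$ be the number of elements of $\mathcal S$ not exceeding $N$; the lower asymptotic density of $\mathcal S$ is $\liminf_{N\to\infty}\mathcal S(N)/N$. Let $\mathcal F=\mathcal P+\mathcal U=\{p+u : p\in\mathcal P,\ u\in\mathcal U\}$. Then there is a constant $c>0$ such that $\mathcal F(N)\ge cN$ for all sufficiently large integers $N$; that is, $\mathcal F$ has positive lower asymptotic density. Moreover, for every integer $k\ge 1$, the set $\mathcal P+k\mathcal U$ has positive lower asymptotic density, where $k\mathcal U=\{v_1+\cdots+v_k : v_1,\dots,v_k\in\mathcal U\}$ is the $k$-fold sumset. -/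

import Mathlib

open scoped Pointwise

/-- The set of prime numbers. -/
def primeSet : Set ℕ := {p | p.Prime}

/-- The set of Fibonacci numbers `u_i`, `i ≥ 2`, that is `{1, 2, 3, 5, 8, …}`. -/
def fibSet : Set ℕ := {u | ∃ i : ℕ, 2 ≤ i ∧ u = Nat.fib i}

/-- The counting function of a set: the number of positive elements not exceeding `N`. -/
noncomputable def countingFn (S : Set ℕ) (N : ℕ) : ℕ := {n : ℕ | n ∈ S ∧ 1 ≤ n ∧ n ≤ N}.ncard

/-- The lower asymptotic density `liminf S(N) / N`. The sequence takes its values in `[0, 1]`,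
so this real `liminf` is the usual one. -/
noncomputable def lowerAsymptoticDensity (S : Set ℕ) : ℝ :=
  Filter.liminf (fun N : ℕ => (countingFn S N : ℝ) / (N : ℝ)) Filter.atTop

/-- The `k`-fold sumset `S + ⋯ + S` (with `k` summands, repetitions allowed). -/
def foldSumset (k : ℕ) (S : Set ℕ) : Set ℕ :=
  {n | ∃ f : Fin k → ℕ, (∀ i, f i ∈ S) ∧ n = ∑ i, f i}

/-! This is Romanoff's second moment method. Take the pairs (p, i) with p ≤ N/2 prime and i ≤ K,
where K is of order log N, and map them to p + F_{4i} ≤ N. By Chebyshev there are ≫ N pairs, so by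
Cauchy–Schwarz a positive proportion of N is hit once the number of collisions p + F_{4i} = q +
F_{4j} is O(N).

Diagonal collisions are harmless. For j < i, Selberg's sieve bounds the number of primes p ≤ N with
p + h prime by O(N / log² N) · h/φ(h), where h = F_{4i} − F_{4j} (`exists_card_prime_pairs_le`). It
remains to show that h/φ(h) is bounded on average over i, j ≤ K.

Indices divisible by 4 make h factor as F_{2(i−j)} L_{2(i+j)}, with L the Lucas numbers, and
L_{2(i+j)} divides F_{4(i+j)}. So h/φ(h) is at most a product of two such ratios at Fibonacci
numbers, and by AM–GM a bounded mean of ∏_{p ∣ F_n} (1 + 6/p) suffices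
(`exists_sum_prod_primeFactors_fib_le`). Expand this product over sets of primes: a set divides F_n
only if its rank e divides n, so the mean is at most ∑ w(e)/e, with w(e) the total weight of the
sets of rank e. All sets of rank ≤ x consist of primes dividing F_1 ⋯ F_x ≤ 2^{x²}, which has too
few small primes for the partial sums of w to exceed O(x^{1/2}); partial summation concludes.

For k summands, pad with copies of 1: a translate of P + U lies in P + kU. -/

/-! ### Mertens-type bounds and products over prime factors. -/

theorem Nat.sum_primesLE_div_mul_log_le_log_factorial (n : ℕ) :
    ∑ p ∈ Nat.primesLE n, ((n / p : ℕ) : ℝ) * Real.log p ≤ Real.log n.factorial := by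
  have hdvd : ∏ p ∈ Nat.primesLE n, p ^ (n / p) ∣ n.factorial := by
    apply Finset.prod_dvd_of_isRelPrime
    · intro p hp q hq hpq
      rw [Function.onFun, ← Nat.coprime_iff_isRelPrime]
      exact Nat.coprime_pow_primes _ _ (Nat.prime_of_mem_primesLE hp)
        (Nat.prime_of_mem_primesLE hq) hpq
    · intro p hp
      -- Each of the multiples p, 2p, 3p, … contributes one factor p; higher powers are ignored.
      have h1 : p ^ (n / p) ∣ (p * (n / p)).factorial := by
        induction n / p with
        | zero => simp
        | succ k ih =>
          rw [pow_succ, mul_add, mul_one]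
          have hp0 := (Nat.prime_of_mem_primesLE hp).pos
          obtain ⟨q, rfl⟩ : ∃ q, p = q + 1 := ⟨p - 1, by omega⟩
          rw [← add_assoc, Nat.factorial_succ, mul_comm]
          exact mul_dvd_mul ⟨k + 1, by ring⟩
            (ih.trans (Nat.factorial_dvd_factorial (by omega)))
      exact h1.trans (Nat.factorial_dvd_factorial (Nat.mul_div_le n p))
  have hle := Nat.le_of_dvd n.factorial_pos hdvd
  have hpos : 0 < ∏ p ∈ Nat.primesLE n, p ^ (n / p) :=
    Finset.prod_pos fun p hp => pow_pos (Nat.prime_of_mem_primesLE hp).pos _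
  calc _ = Real.log ((∏ p ∈ Nat.primesLE n, p ^ (n / p) : ℕ) : ℝ) := by
        push_cast
        rw [Real.log_prod]
        · simp
        · intro p hp
          have := (Nat.prime_of_mem_primesLE hp).pos
          positivity
    _ ≤ _ := Real.log_le_log (by exact_mod_cast hpos) (by exact_mod_cast hle)

/-- The upper bound in Mertens' first theorem. -/
theorem Nat.sum_primesLE_log_div_le {n : ℕ} (hn : 1 ≤ n) :
    ∑ p ∈ Nat.primesLE n, Real.log p / p ≤ Real.log n + Real.log 4 := by
  have hn0 : (0 : ℝ) < n := by exact_mod_cast hn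
  have h1 := Nat.sum_primesLE_div_mul_log_le_log_factorial n
  have h2 : Real.log n.factorial ≤ n * Real.log n := by
    rw [← Real.log_pow]
    exact Real.log_le_log (by exact_mod_cast n.factorial_pos)
      (by exact_mod_cast Nat.factorial_le_pow n)
  have h3 : ∑ p ∈ Nat.primesLE n, Real.log p ≤ Real.log 4 * n := by
    rw [← Chebyshev.theta_eq_sum_primesLE_log]
    exact Chebyshev.theta_le_log4_mul_x hn0.le
  -- Dropping the floor in n / p costs at most log p for each prime, hence θ(n) in total.
  have h4 : n * ∑ p ∈ Nat.primesLE n, Real.log p / p ≤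
      ∑ p ∈ Nat.primesLE n, ((n / p : ℕ) : ℝ) * Real.log p +
        ∑ p ∈ Nat.primesLE n, Real.log p := by
    rw [Finset.mul_sum, ← Finset.sum_add_distrib]
    apply Finset.sum_le_sum
    intro p hp
    have hlog : 0 ≤ Real.log p := Real.log_natCast_nonneg p
    have hfl : (n : ℝ) / p ≤ (n / p : ℕ) + 1 := by
      rw [← Nat.floor_div_eq_div (K := ℝ)]
      exact (Nat.lt_floor_add_one _).le
    calc (n : ℝ) * (Real.log p / p) = (n / p) * Real.log p := by ring
      _ ≤ ((n / p : ℕ) + 1) * Real.log p := by gcongr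
      _ = _ := by ring
  have h5 : n * ∑ p ∈ Nat.primesLE n, Real.log p / p ≤ n * (Real.log n + Real.log 4) := by
    linarith
  exact le_of_mul_le_mul_left h5 hn0

/-- Primes p > exp(1/ε) satisfy 1/p ≤ ε (log p)/p, so Mertens' first theorem applies; the finitely
many others go into C. The sharper log log n is not needed. -/
theorem Nat.exists_sum_primesLE_inv_le {ε : ℝ} (hε : 0 < ε) :
    ∃ C : ℝ, ∀ n : ℕ, 1 ≤ n → ∑ p ∈ Nat.primesLE n, (p : ℝ)⁻¹ ≤ ε * Real.log n + C := by
  set T : ℝ := Real.exp ε⁻¹ with hT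
  refine ⟨∑ p ∈ Nat.primesLE ⌊T⌋₊, (p : ℝ)⁻¹ + ε * Real.log 4, fun n hn => ?_⟩
  have key : ∑ p ∈ Nat.primesLE n, (p : ℝ)⁻¹ ≤
      ∑ p ∈ Nat.primesLE n, ε * (Real.log p / p) + ∑ p ∈ Nat.primesLE ⌊T⌋₊, (p : ℝ)⁻¹ := by
    have h1 : ∑ p ∈ Nat.primesLE n with p ≤ ⌊T⌋₊, (p : ℝ)⁻¹ ≤
        ∑ p ∈ Nat.primesLE ⌊T⌋₊, (p : ℝ)⁻¹ := by
      apply Finset.sum_le_sum_of_subset_of_nonneg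
      · intro p hp
        rw [Finset.mem_filter] at hp
        exact Nat.mem_primesLE.2 ⟨hp.2, Nat.prime_of_mem_primesLE hp.1⟩
      · intros; positivity
    have h2 : ∑ p ∈ Nat.primesLE n with ¬ p ≤ ⌊T⌋₊, (p : ℝ)⁻¹ ≤
        ∑ p ∈ Nat.primesLE n, ε * (Real.log p / p) := by
      calc _ ≤ ∑ p ∈ Nat.primesLE n with ¬ p ≤ ⌊T⌋₊, ε * (Real.log p / p) := by
            apply Finset.sum_le_sum
            intro p hp
            rw [Finset.mem_filter, not_le] at hp
            have hTp : T < p := (Nat.floor_lt (Real.exp_pos _).le).1 hp.2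
            have hlog : ε⁻¹ ≤ Real.log p := by
              rw [Real.le_log_iff_exp_le ((Real.exp_pos _).trans hTp)]; exact hTp.le
            have h6 : 1 ≤ ε * Real.log p := by
              calc (1 : ℝ) = ε * ε⁻¹ := by field_simp
                _ ≤ _ := by gcongr
            calc (p : ℝ)⁻¹ = 1 * (p : ℝ)⁻¹ := by ring
              _ ≤ (ε * Real.log p) * (p : ℝ)⁻¹ := by gcongr
              _ = _ := by ring
        _ ≤ _ := by
            apply Finset.sum_le_sum_of_subset_of_nonneg (Finset.filter_subset _ _)
            intro p _ _
            have := Real.log_natCast_nonneg p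
            positivity
    rw [← Finset.sum_filter_add_sum_filter_not (Nat.primesLE n) (fun p => p ≤ ⌊T⌋₊)]
    linarith
  rw [← Finset.mul_sum] at key
  have := mul_le_mul_of_nonneg_left (Nat.sum_primesLE_log_div_le hn) hε.le
  linarith

theorem Nat.card_primeFactors_le_log {n : ℕ} (hn : n ≠ 0) : n.primeFactors.card ≤ Nat.log 2 n := by
  apply Nat.le_log_of_pow_le one_lt_two
  calc 2 ^ n.primeFactors.card = ∏ _p ∈ n.primeFactors, 2 := by simp
    _ ≤ ∏ p ∈ n.primeFactors, p :=
        Finset.prod_le_prod' fun p hp => (Nat.prime_of_mem_primeFactors hp).two_le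
    _ ≤ n := Nat.le_of_dvd (Nat.pos_of_ne_zero hn) (Nat.prod_primeFactors_dvd n)

/-- Here y stands for log n: there are at most y prime factors, so those above y contribute at most
y · (1/y) = 1. -/
theorem Nat.sum_primeFactors_inv_le {n y : ℕ} (hn : n ≠ 0) (hy : 1 ≤ y) (hny : n ≤ 2 ^ y) :
    ∑ p ∈ n.primeFactors, (p : ℝ)⁻¹ ≤ ∑ p ∈ Nat.primesLE y, (p : ℝ)⁻¹ + 1 := by
  have hy0 : (0 : ℝ) < y := by exact_mod_cast hy
  have hcard : n.primeFactors.card ≤ y :=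
    (Nat.card_primeFactors_le_log hn).trans
      ((Nat.log_mono_right hny).trans (Nat.log_pow one_lt_two y).le)
  rw [← Finset.sum_filter_add_sum_filter_not n.primeFactors (fun p => p ≤ y)]
  gcongr ?_ + ?_
  · apply Finset.sum_le_sum_of_subset_of_nonneg
    · intro p hp
      rw [Finset.mem_filter] at hp
      exact Nat.mem_primesLE.2 ⟨hp.2, Nat.prime_of_mem_primeFactors hp.1⟩
    · intros; positivity
  · calc _ ≤ ∑ p ∈ n.primeFactors with ¬ p ≤ y, (y : ℝ)⁻¹ := by
          apply Finset.sum_le_sum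
          intro p hp
          rw [Finset.mem_filter, not_le] at hp
          have : (y : ℝ) < p := by exact_mod_cast hp.2
          gcongr
      _ ≤ ∑ p ∈ n.primeFactors, (y : ℝ)⁻¹ :=
          Finset.sum_le_sum_of_subset_of_nonneg (Finset.filter_subset _ _)
            (by intros; positivity)
      _ = n.primeFactors.card * (y : ℝ)⁻¹ := by simp
      _ ≤ y * (y : ℝ)⁻¹ := by gcongr
      _ = 1 := by field_simp

theorem Nat.exists_prod_primeFactors_one_add_le (c : ℝ) (hc : 0 < c) {ε : ℝ} (hε : 0 < ε) :
    ∃ C : ℝ, 0 < C ∧ ∀ n y : ℕ, n ≠ 0 → 1 ≤ y → n ≤ 2 ^ y →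
      ∏ p ∈ n.primeFactors, (1 + c / p) ≤ C * (y : ℝ) ^ ε := by
  obtain ⟨C, hC⟩ := Nat.exists_sum_primesLE_inv_le (_root_.div_pos hε hc)
  refine ⟨Real.exp (c * (C + 1)), Real.exp_pos _, fun n y hn hy hny => ?_⟩
  have hy0 : (0 : ℝ) < y := by exact_mod_cast hy
  calc ∏ p ∈ n.primeFactors, (1 + c / p)
      ≤ ∏ p ∈ n.primeFactors, Real.exp (c * (p : ℝ)⁻¹) := by
        apply Finset.prod_le_prod
        · intros; positivity
        · intro p _
          rw [add_comm, div_eq_mul_inv]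
          exact Real.add_one_le_exp _
    _ = Real.exp (c * ∑ p ∈ n.primeFactors, (p : ℝ)⁻¹) := by
        rw [Finset.mul_sum, Real.exp_sum]
    _ ≤ Real.exp (c * (ε / c * Real.log y + C + 1)) := by
        have := Nat.sum_primeFactors_inv_le hn hy hny
        have := hC y hy
        gcongr
        linarith
    _ = _ := by
        rw [Real.rpow_def_of_pos hy0, ← Real.exp_add]
        congr 1
        field_simp
        ring

/-! ### The mean of ∏ (1 + c/p) over the primes dividing Fibonacci numbers. -/

/-- Abel summation turns the sum into terms B(e)/(e(e+1)) ≪ e^{−3/2}; any exponent below 1 in the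
hypothesis would do. -/
theorem Finset.sum_Icc_div_le_of_sum_le_rpow {b : ℕ → ℝ} {C : ℝ} (hC : 0 ≤ C)
    (hB : ∀ x : ℕ, 1 ≤ x → ∑ e ∈ Finset.Icc 1 x, b e ≤ C * (x : ℝ) ^ (1 / 2 : ℝ)) :
    ∃ D : ℝ, 0 < D ∧ ∀ x : ℕ, ∑ e ∈ Finset.Icc 1 x, b e / e ≤ D := by
  have hsum : Summable fun n : ℕ => ((n : ℝ) ^ (3 / 2 : ℝ))⁻¹ :=
    Real.summable_nat_rpow_inv.2 (by norm_num)
  set B : ℕ → ℝ := fun x => ∑ e ∈ Finset.Icc 1 x, b e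
  have habel : ∀ x : ℕ, ∑ e ∈ Finset.Icc 1 (x + 1), b e / e =
      B (x + 1) / (x + 1) + ∑ e ∈ Finset.Icc 1 x, B e / (e * (e + 1)) := by
    intro x
    induction x with
    | zero => simp [B]
    | succ k ih =>
      rw [Finset.sum_Icc_succ_top (by omega), ih, Finset.sum_Icc_succ_top (by omega)]
      have : B (k + 1 + 1) = B (k + 1) + b (k + 1 + 1) := Finset.sum_Icc_succ_top (by omega) _
      rw [this]
      push_cast
      field_simp
      ring
  have hterm : ∀ e : ℕ, 1 ≤ e → B e / (e * (e + 1)) ≤ C * ((e : ℝ) ^ (3 / 2 : ℝ))⁻¹ := by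
    intro e he
    have he0 : (0 : ℝ) < e := by exact_mod_cast he
    calc B e / (e * (e + 1)) ≤ C * (e : ℝ) ^ (1 / 2 : ℝ) / (e * (e + 1)) := by
          gcongr; exact hB e he
      _ ≤ C * (e : ℝ) ^ (1 / 2 : ℝ) / (e * e) := by gcongr; linarith
      _ = C * ((e : ℝ) ^ (3 / 2 : ℝ))⁻¹ := by
          rw [mul_div_assoc, ← Real.rpow_neg he0.le, ← sq, ← Real.rpow_natCast (e : ℝ) 2,
            ← Real.rpow_sub he0]
          norm_num
  refine ⟨C + C * ∑' n : ℕ, ((n : ℝ) ^ (3 / 2 : ℝ))⁻¹ + 1, by positivity, fun x => ?_⟩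
  obtain _ | x := x
  · simp only [zero_lt_one, Finset.Icc_eq_empty_of_lt, Finset.sum_empty]; positivity
  rw [habel]
  have h1 : B (x + 1) / (x + 1) ≤ C := by
    rw [div_le_iff₀ (by positivity)]
    refine (hB (x + 1) (by omega)).trans ?_
    push_cast
    gcongr
    calc ((x : ℝ) + 1) ^ (1 / 2 : ℝ) ≤ ((x : ℝ) + 1) ^ (1 : ℝ) := by
          apply Real.rpow_le_rpow_of_exponent_le <;> norm_num
      _ = _ := by simp
  have h2 : ∑ e ∈ Finset.Icc 1 x, B e / (e * (e + 1)) ≤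
      C * ∑' n : ℕ, ((n : ℝ) ^ (3 / 2 : ℝ))⁻¹ := by
    calc _ ≤ ∑ e ∈ Finset.Icc 1 x, C * ((e : ℝ) ^ (3 / 2 : ℝ))⁻¹ :=
          Finset.sum_le_sum fun e he => hterm e (Finset.mem_Icc.1 he).1
      _ = C * ∑ e ∈ Finset.Icc 1 x, ((e : ℝ) ^ (3 / 2 : ℝ))⁻¹ := by rw [Finset.mul_sum]
      _ ≤ _ := by
          gcongr
          exact hsum.sum_le_tsum _ (by intros; positivity)
  linarith

/-- The least positive index `n` for which every prime of `s` divides the `n`-th Fibonacci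
number. -/
noncomputable def fibRank (s : Finset ℕ) : ℕ := sInf {n | 0 < n ∧ s ⊆ (Nat.fib n).primeFactors}

/-- Since gcd(F_m, F_n) = F_{gcd(m, n)}, the admissible indices are closed under gcd, so the least
one divides all others. -/
theorem fibRank_spec {s : Finset ℕ} {n : ℕ} (hn : 0 < n) (hs : s ⊆ (Nat.fib n).primeFactors) :
    0 < fibRank s ∧ s ⊆ (Nat.fib (fibRank s)).primeFactors ∧ fibRank s ∣ n := by
  have hmem : fibRank s ∈ {n | 0 < n ∧ s ⊆ (Nat.fib n).primeFactors} := Nat.sInf_mem ⟨n, hn, hs⟩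
  refine ⟨hmem.1, hmem.2, ?_⟩
  have hg : Nat.gcd (fibRank s) n ∈ {n | 0 < n ∧ s ⊆ (Nat.fib n).primeFactors} := by
    refine ⟨Nat.gcd_pos_of_pos_right _ hn, fun p hp => ?_⟩
    have h1 := Nat.mem_primeFactors.1 (hmem.2 hp)
    have h2 := Nat.mem_primeFactors.1 (hs hp)
    rw [Nat.fib_gcd]
    exact Nat.mem_primeFactors.2 ⟨h1.1, Nat.dvd_gcd h1.2.1 h2.2.1,
      (Nat.gcd_pos_of_pos_right _ (Nat.fib_pos.2 hn)).ne'⟩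
  have hle : fibRank s ≤ Nat.gcd (fibRank s) n := Nat.sInf_le hg
  exact Nat.gcd_eq_left_iff_dvd.1 (le_antisymm (Nat.gcd_le_left _ hmem.1) hle)

theorem Nat.fib_le_two_pow (n : ℕ) : Nat.fib n ≤ 2 ^ n := by
  induction n using Nat.twoStepInduction with
  | zero => simp
  | one => simp
  | more n h1 h2 => rw [Nat.fib_add_two, pow_succ]; rw [pow_succ] at *; omega

/-- The contribution of the sets of primes of rank `e` to the expansion of
`∏ (1 + c / p)` over the prime factors of Fibonacci numbers. -/
noncomputable def rankWeight (c : ℝ) (e : ℕ) : ℝ :=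
  ∑ s ∈ (Nat.fib e).primeFactors.powerset with fibRank s = e, ∏ p ∈ s, c / p

theorem rankWeight_nonneg {c : ℝ} (hc : 0 < c) (e : ℕ) : 0 ≤ rankWeight c e :=
  Finset.sum_nonneg fun _ _ => Finset.prod_nonneg fun _ _ => by positivity

/-- Every set counted consists of primes dividing M = F_1 ⋯ F_x, and has only one rank, so the sum
is at most ∏_{p ∣ M} (1 + c/p). As M ≤ 2^{x²}, the exponent 1/4 on x² becomes 1/2 on x. -/
theorem sum_rankWeight_le {c : ℝ} (hc : 0 < c) : ∃ C : ℝ, 0 ≤ C ∧ ∀ x : ℕ, 1 ≤ x →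
    ∑ e ∈ Finset.Icc 1 x, rankWeight c e ≤ C * (x : ℝ) ^ (1 / 2 : ℝ) := by
  obtain ⟨C, hC0, hC⟩ := Nat.exists_prod_primeFactors_one_add_le c hc
    (show (0 : ℝ) < 1 / 4 by norm_num)
  refine ⟨C, hC0.le, fun x hx => ?_⟩
  set M : ℕ := ∏ n ∈ Finset.Icc 1 x, Nat.fib n with hM
  have hM0 : M ≠ 0 := by
    rw [hM, Finset.prod_ne_zero_iff]
    intro n hn
    exact (Nat.fib_pos.2 (Finset.mem_Icc.1 hn).1).ne'
  have hMle : M ≤ 2 ^ (x ^ 2) := by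
    calc M ≤ ∏ n ∈ Finset.Icc 1 x, 2 ^ x := Finset.prod_le_prod' fun n hn =>
          (Nat.fib_le_two_pow n).trans
            (Nat.pow_le_pow_right (by norm_num) (Finset.mem_Icc.1 hn).2)
      _ = 2 ^ (x ^ 2) := by simp [← pow_mul, sq]
  calc ∑ e ∈ Finset.Icc 1 x, rankWeight c e
      ≤ ∑ e ∈ Finset.Icc 1 x, ∑ s ∈ M.primeFactors.powerset with fibRank s = e,
          ∏ p ∈ s, c / p := by
        apply Finset.sum_le_sum
        intro e he
        apply Finset.sum_le_sum_of_subset_of_nonneg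
        · apply Finset.filter_subset_filter
          apply Finset.powerset_mono.2
          exact Nat.primeFactors_mono (Finset.dvd_prod_of_mem _ he) hM0
        · intro _ _ _
          exact Finset.prod_nonneg fun _ _ => by positivity
    _ ≤ ∑ s ∈ M.primeFactors.powerset, ∏ p ∈ s, c / p := by
        apply Finset.sum_fiberwise_le_sum_of_sum_fiber_nonneg
        intro _ _
        exact Finset.sum_nonneg fun _ _ => Finset.prod_nonneg fun _ _ => by positivity
    _ = ∏ p ∈ M.primeFactors, (1 + c / p) := (Finset.prod_one_add _).symm
    _ ≤ C * ((x ^ 2 : ℕ) : ℝ) ^ (1 / 4 : ℝ) := hC _ _ hM0 (Nat.one_le_pow _ _ hx) hMle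
    _ = C * (x : ℝ) ^ (1 / 2 : ℝ) := by
        rw [Nat.cast_pow, ← Real.rpow_natCast, ← Real.rpow_mul (Nat.cast_nonneg x)]
        norm_num

theorem prod_primeFactors_fib_le_sum_divisors {c : ℝ} (hc : 0 < c) {n : ℕ} (hn : 0 < n) :
    ∏ p ∈ (Nat.fib n).primeFactors, (1 + c / p) ≤ ∑ e ∈ n.divisors, rankWeight c e := by
  rw [Finset.prod_one_add, ← Finset.sum_fiberwise_of_maps_to (t := n.divisors) (g := fibRank)]
  · apply Finset.sum_le_sum
    intro e _
    apply Finset.sum_le_sum_of_subset_of_nonneg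
    · intro s hs
      rw [Finset.mem_filter, Finset.mem_powerset] at hs ⊢
      obtain ⟨hs, rfl⟩ := hs
      exact ⟨(fibRank_spec hn hs).2.1, rfl⟩
    · intro _ _ _
      exact Finset.prod_nonneg fun _ _ => by positivity
  · intro s hs
    exact Nat.mem_divisors.2 ⟨(fibRank_spec hn (Finset.mem_powerset.1 hs)).2.2, hn.ne'⟩

/-- Interchange the sums over n and e ∣ n: each rank e has at most X/e multiples up to X. -/
theorem exists_sum_prod_primeFactors_fib_le {c : ℝ} (hc : 0 < c) : ∃ D : ℝ, 0 < D ∧ ∀ X : ℕ,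
    ∑ n ∈ Finset.Icc 1 X, ∏ p ∈ (Nat.fib n).primeFactors, (1 + c / p) ≤ D * X := by
  obtain ⟨C, hC0, hC⟩ := sum_rankWeight_le hc
  obtain ⟨D, hD0, hD⟩ := Finset.sum_Icc_div_le_of_sum_le_rpow hC0 hC
  refine ⟨D, hD0, fun X => ?_⟩
  calc _ ≤ ∑ n ∈ Finset.Icc 1 X, ∑ e ∈ n.divisors, rankWeight c e :=
        Finset.sum_le_sum fun n hn =>
          prod_primeFactors_fib_le_sum_divisors hc (Finset.mem_Icc.1 hn).1
    _ = ∑ e ∈ Finset.Icc 1 X, ∑ n ∈ Finset.Icc 1 X with e ∣ n, rankWeight c e := by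
        apply Finset.sum_comm'
        intro n e
        simp only [Finset.mem_Icc, Finset.mem_filter, Nat.mem_divisors]
        constructor
        · rintro ⟨⟨h1, h2⟩, h3, -⟩
          have := Nat.le_of_dvd h1 h3
          have := Nat.pos_of_dvd_of_pos h3 h1
          exact ⟨⟨⟨h1, h2⟩, h3⟩, by omega, by omega⟩
        · rintro ⟨⟨⟨h1, h2⟩, h3⟩, -⟩
          exact ⟨⟨h1, h2⟩, h3, by omega⟩
    _ ≤ ∑ e ∈ Finset.Icc 1 X, X * (rankWeight c e / e) := by
        apply Finset.sum_le_sum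
        intro e _
        have hcard : (Finset.Icc 1 X |>.filter (e ∣ ·)).card = X / e :=
          Nat.Ioc_filter_dvd_card_eq_div X e
        rw [Finset.sum_const, hcard, nsmul_eq_mul]
        calc ((X / e : ℕ) : ℝ) * rankWeight c e ≤ (X / e) * rankWeight c e := by
              gcongr
              · exact rankWeight_nonneg hc e
              · exact Nat.cast_div_le
          _ = _ := by ring
    _ = X * ∑ e ∈ Finset.Icc 1 X, rankWeight c e / e := by rw [Finset.mul_sum]
    _ ≤ X * D := by gcongr; exact hD X
    _ = D * X := mul_comm _ _

/-! ### Selberg's upper bound sieve. -/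

theorem Nat.sum_divisors_moebius_of_dvd {m l : ℕ} (hm : Squarefree m) (hl : l ∣ m) :
    ∑ d ∈ m.divisors with l ∣ d, ArithmeticFunction.moebius d =
      if l = m then ArithmeticFunction.moebius l else 0 := by
  obtain ⟨k, rfl⟩ := hl
  have hlk0 := hm.ne_zero
  have hl0 : l ≠ 0 := left_ne_zero_of_mul hlk0
  have hk0 : k ≠ 0 := right_ne_zero_of_mul hlk0
  have hcop : l.Coprime k := (Nat.squarefree_mul_iff.1 hm).1
  have h1 : (l * k).divisors.filter (l ∣ ·) = k.divisors.image (l * ·) := by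
    ext d
    simp only [Finset.mem_filter, Nat.mem_divisors, Finset.mem_image]
    constructor
    · rintro ⟨⟨h1, -⟩, e, rfl⟩
      exact ⟨e, ⟨Nat.dvd_of_mul_dvd_mul_left (Nat.pos_of_ne_zero hl0) h1, hk0⟩, rfl⟩
    · rintro ⟨e, ⟨h1, -⟩, rfl⟩
      exact ⟨⟨Nat.mul_dvd_mul_left l h1, hlk0⟩, dvd_mul_right _ _⟩
  rw [h1, Finset.sum_image (fun a _ b _ h => Nat.eq_of_mul_eq_mul_left (Nat.pos_of_ne_zero hl0) h)]
  have h2 : ∀ e ∈ k.divisors, ArithmeticFunction.moebius (l * e) =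
      ArithmeticFunction.moebius l * ArithmeticFunction.moebius e := fun e he =>
    ArithmeticFunction.isMultiplicative_moebius.map_mul_of_coprime
      (hcop.coprime_dvd_right (Nat.dvd_of_mem_divisors he))
  rw [Finset.sum_congr rfl h2, ← Finset.mul_sum, ← ArithmeticFunction.coe_zeta_mul_apply,
    ArithmeticFunction.coe_zeta_mul_moebius, ArithmeticFunction.one_apply]
  have h3 : (l = l * k) ↔ k = 1 := by
    constructor
    · intro h
      exact Nat.eq_of_mul_eq_mul_left (Nat.pos_of_ne_zero hl0) (by omega)
    · rintro rfl; simp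
  simp [h3]

namespace BoundingSieve

/-- The sum of the Selberg terms up to `z`. -/
noncomputable def selbergSum (s : BoundingSieve) (z : ℕ) : ℝ :=
  ∑ l ∈ s.prodPrimes.divisors with l ≤ z, s.selbergTerms l

/-- The optimal weights of the Selberg sieve. -/
noncomputable def selbergWeight (s : BoundingSieve) (z d : ℕ) : ℝ :=
  (s.nu d)⁻¹ * ArithmeticFunction.moebius d *
    (∑ l ∈ s.prodPrimes.divisors with l ≤ z ∧ d ∣ l, s.selbergTerms l) / s.selbergSum z

variable (s : BoundingSieve) {z : ℕ}

theorem selbergSum_pos (hz : 1 ≤ z) : 0 < s.selbergSum z := by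
  apply Finset.sum_pos
  · intro l hl
    rw [Finset.mem_filter, Nat.mem_divisors] at hl
    exact selbergTerms_pos hl.1.1
  · exact ⟨1, by simp [prodPrimes_ne_zero, hz]⟩

theorem selbergWeight_one (hz : 1 ≤ z) : s.selbergWeight z 1 = 1 := by
  have := (s.selbergSum_pos hz).ne'
  have h1 : s.nu 1 = 1 := s.nu_mult.map_one
  simp only [selbergWeight, h1, one_dvd, and_true]
  change 1⁻¹ * _ * s.selbergSum z / _ = 1
  simp [this]

theorem selbergWeight_eq_zero {d : ℕ} (hd : z < d) : s.selbergWeight z d = 0 := by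
  have : s.prodPrimes.divisors.filter (fun l => l ≤ z ∧ d ∣ l) = ∅ := by
    rw [Finset.filter_eq_empty_iff]
    rintro l hl ⟨h1, h2⟩
    have := Nat.le_of_dvd (Nat.pos_of_mem_divisors hl) h2
    omega
  simp [selbergWeight, this]

/-- These sums are the variables that diagonalise Selberg's quadratic form. Möbius inversion over
the multiples of l recovers the single term m = l from the inner sum in `selbergWeight`. -/
theorem sum_nu_mul_selbergWeight {l : ℕ} (hl : l ∣ s.prodPrimes) :
    ∑ d ∈ s.prodPrimes.divisors, (if l ∣ d then s.nu d * s.selbergWeight z d else 0) =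
      if l ≤ z then s.selbergTerms l * ArithmeticFunction.moebius l / s.selbergSum z else 0 := by
  calc _ = ∑ d ∈ s.prodPrimes.divisors, ∑ m ∈ s.prodPrimes.divisors,
        (if l ∣ d ∧ m ≤ z ∧ d ∣ m then
          (ArithmeticFunction.moebius d : ℝ) * (s.selbergTerms m / s.selbergSum z) else 0) := by
        apply Finset.sum_congr rfl
        intro d hd
        split_ifs with h
        · have := nu_ne_zero (s := s) (Nat.dvd_of_mem_divisors hd)
          rw [selbergWeight, Finset.sum_filter, mul_div_assoc, Finset.sum_div, Finset.mul_sum,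
            Finset.mul_sum]
          apply Finset.sum_congr rfl
          intro m _
          by_cases h' : m ≤ z ∧ d ∣ m
          · simp only [h', h, and_self, if_true]
            field_simp
          · simp [h', h]
        · simp [h]
    _ = ∑ m ∈ s.prodPrimes.divisors, ∑ d ∈ s.prodPrimes.divisors,
        (if l ∣ d ∧ m ≤ z ∧ d ∣ m then
          (ArithmeticFunction.moebius d : ℝ) * (s.selbergTerms m / s.selbergSum z) else 0) :=
        Finset.sum_comm
    _ = ∑ m ∈ s.prodPrimes.divisors, if m = l then
          (if l ≤ z then s.selbergTerms l * ArithmeticFunction.moebius l / s.selbergSum z else 0)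
          else 0 := by
        apply Finset.sum_congr rfl
        intro m hm
        have hmP := Nat.dvd_of_mem_divisors hm
        by_cases hmz : m ≤ z
        · have h1 : ∑ d ∈ s.prodPrimes.divisors,
              (if l ∣ d ∧ m ≤ z ∧ d ∣ m then (ArithmeticFunction.moebius d : ℝ) *
                (s.selbergTerms m / s.selbergSum z) else 0) =
              ((∑ d ∈ m.divisors with l ∣ d, ArithmeticFunction.moebius d : ℤ) : ℝ) *
                (s.selbergTerms m / s.selbergSum z) := by
            rw [← Nat.divisors_filter_dvd_of_dvd prodPrimes_ne_zero hmP, Finset.filter_filter,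
              Int.cast_sum, Finset.sum_mul, Finset.sum_filter]
            apply Finset.sum_congr rfl
            intro d _
            simp [hmz, and_comm]
          rw [h1]
          by_cases hlm : l ∣ m
          · rw [Nat.sum_divisors_moebius_of_dvd (squarefree_of_dvd_prodPrimes hmP) hlm]
            by_cases h : l = m
            · subst h; simp only [if_true, hmz]; ring
            · simp [h, Ne.symm h]
          · have h2 : m.divisors.filter (l ∣ ·) = ∅ := by
              rw [Finset.filter_eq_empty_iff]
              intro d hd h
              exact hlm (h.trans (Nat.dvd_of_mem_divisors hd))
            have h3 : m ≠ l := by rintro rfl; exact hlm dvd_rfl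
            simp [h2, h3]
        · by_cases h : m = l
          · subst h; simp [hmz]
          · simp [h, hmz]
    _ = _ := by
        rw [Finset.sum_ite_eq' _ l]
        simp [hl, prodPrimes_ne_zero]

theorem mainSum_selbergWeight (hz : 1 ≤ z) :
    s.mainSum (lambdaSquared (s.selbergWeight z)) = (s.selbergSum z)⁻¹ := by
  have hS := (s.selbergSum_pos hz).ne'
  rw [mainSum_lambdaSquared_eq_sum_mul_sum_sq]
  calc _ = ∑ l ∈ s.prodPrimes.divisors,
        if l ≤ z then s.selbergTerms l / s.selbergSum z ^ 2 else 0 := by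
        apply Finset.sum_congr rfl
        intro l hl
        have hlP := Nat.dvd_of_mem_divisors hl
        rw [s.sum_nu_mul_selbergWeight hlP]
        split_ifs with h
        · have h1 : ((ArithmeticFunction.moebius l : ℤ) : ℝ) ^ 2 = 1 := by
            exact_mod_cast ArithmeticFunction.moebius_sq_eq_one_of_squarefree
              (squarefree_of_dvd_prodPrimes hlP)
          have := (selbergTerms_pos hlP).ne'
          rw [div_pow, mul_pow, h1]
          field_simp
        · simp
    _ = s.selbergSum z / s.selbergSum z ^ 2 := by
        rw [← Finset.sum_filter, selbergSum, Finset.sum_div]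
    _ = _ := by field_simp

/-- The inner sum is part of `selbergSum`, so the quotient is at most 1 and only 1/ν(d) is left. -/
theorem abs_selbergWeight_le (hz : 1 ≤ z) {d : ℕ} (hd : d ∣ s.prodPrimes)
    (hnu : (s.nu d)⁻¹ ≤ d) : |s.selbergWeight z d| ≤ d := by
  have hS := s.selbergSum_pos hz
  have hnu0 := nu_pos_of_dvd_prodPrimes hd
  have h1 : |((ArithmeticFunction.moebius d : ℤ) : ℝ)| ≤ 1 := by
    exact_mod_cast ArithmeticFunction.abs_moebius_le_one
  have hpos : ∀ l ∈ s.prodPrimes.divisors, 0 ≤ s.selbergTerms l := fun l hl =>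
    (selbergTerms_pos (Nat.dvd_of_mem_divisors hl)).le
  have h2 : ∑ l ∈ s.prodPrimes.divisors with l ≤ z ∧ d ∣ l, s.selbergTerms l ≤ s.selbergSum z := by
    apply Finset.sum_le_sum_of_subset_of_nonneg
    · intro l hl
      simp only [Finset.mem_filter] at hl ⊢
      exact ⟨hl.1, hl.2.1⟩
    · intro l hl _
      exact hpos l (Finset.mem_filter.1 hl).1
  have h3 : 0 ≤ ∑ l ∈ s.prodPrimes.divisors with l ≤ z ∧ d ∣ l, s.selbergTerms l :=
    Finset.sum_nonneg fun l hl => hpos l (Finset.mem_filter.1 hl).1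
  rw [selbergWeight, mul_div_assoc, abs_mul, abs_mul, abs_of_pos (inv_pos.2 hnu0),
    abs_of_nonneg (div_nonneg h3 hS.le)]
  calc _ ≤ (d : ℝ) * 1 * 1 := by
        gcongr
        rw [div_le_one hS]
        exact h2
    _ = d := by ring

/-- Only d ≤ z² matter. The weights have absolute sum at most z², so each coefficient is at most z⁴;
with remainders at most z² and z² values of d, this makes z⁸. -/
theorem errSum_selbergWeight_le (hz : 1 ≤ z) (hnu : ∀ d, d ∣ s.prodPrimes → (s.nu d)⁻¹ ≤ d)
    (hrem : ∀ d, d ∣ s.prodPrimes → |s.rem d| ≤ d) :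
    s.errSum (lambdaSquared (s.selbergWeight z)) ≤ (z : ℝ) ^ 8 := by
  have hbound : ∀ d, d ∣ s.prodPrimes →
      |lambdaSquared (s.selbergWeight z) d| ≤ if d ≤ z ^ 2 then (z : ℝ) ^ 4 else 0 := by
    intro d hd
    have hd0 : d ≠ 0 := ne_zero_of_dvd_ne_zero prodPrimes_ne_zero hd
    split_ifs with hdz
    · have hsum : ∑ e ∈ d.divisors, |s.selbergWeight z e| ≤ (z : ℝ) ^ 2 := by
        calc _ ≤ ∑ e ∈ d.divisors, (if e ∈ Finset.Icc 1 z then (z : ℝ) else 0) := by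
              apply Finset.sum_le_sum
              intro e he
              have hed := Nat.dvd_of_mem_divisors he
              by_cases hez : e ≤ z
              · rw [if_pos (Finset.mem_Icc.2 ⟨Nat.pos_of_mem_divisors he, hez⟩)]
                exact (s.abs_selbergWeight_le hz (hed.trans hd) (hnu e (hed.trans hd))).trans
                  (by exact_mod_cast hez)
              · rw [s.selbergWeight_eq_zero (not_le.1 hez), abs_zero]
                split_ifs <;> positivity
          _ = ∑ e ∈ d.divisors with e ∈ Finset.Icc 1 z, (z : ℝ) := by rw [Finset.sum_filter]
          _ ≤ ∑ e ∈ Finset.Icc 1 z, (z : ℝ) := by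
              apply Finset.sum_le_sum_of_subset_of_nonneg
              · intro e he; exact (Finset.mem_filter.1 he).2
              · intros; positivity
          _ = (z : ℝ) ^ 2 := by simp [sq]
      calc |lambdaSquared (s.selbergWeight z) d|
          ≤ ∑ d1 ∈ d.divisors, ∑ d2 ∈ d.divisors,
              |s.selbergWeight z d1| * |s.selbergWeight z d2| := by
            refine (Finset.abs_sum_le_sum_abs _ _).trans (Finset.sum_le_sum fun d1 _ => ?_)
            refine (Finset.abs_sum_le_sum_abs _ _).trans (Finset.sum_le_sum fun d2 _ => ?_)
            split_ifs
            · rw [abs_mul]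
            · rw [abs_zero]; positivity
        _ = (∑ e ∈ d.divisors, |s.selbergWeight z e|) ^ 2 := by
            rw [sq, Finset.sum_mul_sum]
        _ ≤ ((z : ℝ) ^ 2) ^ 2 := by gcongr
        _ = _ := by ring
    · have : lambdaSquared (s.selbergWeight z) d = 0 := by
        apply Finset.sum_eq_zero
        intro d1 hd1
        apply Finset.sum_eq_zero
        intro d2 hd2
        split_ifs with h
        · by_cases h1 : z < d1
          · rw [s.selbergWeight_eq_zero h1, zero_mul]
          by_cases h2 : z < d2
          · rw [s.selbergWeight_eq_zero h2, mul_zero]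
          exfalso
          apply hdz
          rw [h, sq]
          exact (Nat.le_of_dvd (Nat.mul_pos (Nat.pos_of_mem_divisors hd1)
            (Nat.pos_of_mem_divisors hd2)) (Nat.lcm_dvd_mul _ _)).trans
            (Nat.mul_le_mul (not_lt.1 h1) (not_lt.1 h2))
        · rfl
      rw [this, abs_zero]
  calc s.errSum (lambdaSquared (s.selbergWeight z))
      ≤ ∑ d ∈ s.prodPrimes.divisors, if d ∈ Finset.Icc 1 (z ^ 2) then (z : ℝ) ^ 4 * (z : ℝ) ^ 2
          else 0 := by
        apply Finset.sum_le_sum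
        intro d hd
        have hdP := Nat.dvd_of_mem_divisors hd
        have h1 := hbound d hdP
        by_cases hdz : d ≤ z ^ 2
        · rw [if_pos hdz] at h1
          rw [if_pos (Finset.mem_Icc.2 ⟨Nat.pos_of_mem_divisors hd, hdz⟩)]
          have h2 : |s.rem d| ≤ (z : ℝ) ^ 2 := (hrem d hdP).trans (by exact_mod_cast hdz)
          gcongr
        · rw [if_neg hdz] at h1
          rw [abs_nonpos_iff.1 h1, abs_zero, zero_mul]
          split_ifs <;> positivity
    _ = ∑ d ∈ s.prodPrimes.divisors with d ∈ Finset.Icc 1 (z ^ 2), (z : ℝ) ^ 4 * (z : ℝ) ^ 2 := by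
        rw [Finset.sum_filter]
    _ ≤ ∑ d ∈ Finset.Icc 1 (z ^ 2), (z : ℝ) ^ 4 * (z : ℝ) ^ 2 := by
        apply Finset.sum_le_sum_of_subset_of_nonneg
        · intro e he; exact (Finset.mem_filter.1 he).2
        · intros; positivity
    _ = (z : ℝ) ^ 8 := by simp; ring

/-- Selberg's upper bound sieve, with a crude error term. -/
theorem siftedSum_le_totalMass_div_selbergSum (hz : 1 ≤ z)
    (hnu : ∀ d, d ∣ s.prodPrimes → (s.nu d)⁻¹ ≤ d)
    (hrem : ∀ d, d ∣ s.prodPrimes → |s.rem d| ≤ d) :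
    s.siftedSum ≤ s.totalMass / s.selbergSum z + (z : ℝ) ^ 8 := by
  have h := siftedSum_le_mainSum_errSum_of_upperMoebius (s := s) _
    (upperMoebius_lambdaSquared (s.selbergWeight z) (s.selbergWeight_one hz))
  rw [s.mainSum_selbergWeight hz] at h
  rw [div_eq_mul_inv]
  linarith [s.errSum_selbergWeight_le hz hnu hrem]

end BoundingSieve

/-! ### The sieve problem for prime pairs p, p + h. -/

/-- The residues `v` modulo `d` with `v (v + h) ≡ 0`. -/
def pairRoots (h d : ℕ) : Finset ℕ := (Finset.range d).filter fun v => d ∣ v * (v + h)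

theorem card_pairRoots_le (h d : ℕ) : (pairRoots h d).card ≤ d :=
  (Finset.card_filter_le _ _).trans (by simp)

theorem zero_mem_pairRoots (h : ℕ) {d : ℕ} (hd : 0 < d) : 0 ∈ pairRoots h d := by
  simp [pairRoots, hd]

theorem card_pairRoots_eq (h d : ℕ) [NeZero d] :
    (pairRoots h d).card = Nat.card {x : ZMod d // x * (x + h) = 0} := by
  rw [← Fintype.card_coe, ← Nat.card_eq_fintype_card]
  have key : ∀ v : ℕ, d ∣ v * (v + h) ↔ (v : ZMod d) * (v + h) = 0 := by
    intro v
    rw [← ZMod.natCast_eq_zero_iff]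
    push_cast
    rfl
  refine Nat.card_congr ⟨fun v => ⟨(v.1 : ZMod d), (key v.1).1 (Finset.mem_filter.1 v.2).2⟩,
    fun x => ⟨x.1.val, ?_⟩, ?_, ?_⟩
  · rw [pairRoots, Finset.mem_filter, Finset.mem_range, key, ZMod.natCast_zmod_val]
    exact ⟨ZMod.val_lt _, x.2⟩
  · intro v
    ext
    exact ZMod.val_cast_of_lt (Finset.mem_range.1 (Finset.mem_filter.1 v.2).1)
  · intro x
    ext
    simp

theorem card_pairRoots_mul (h : ℕ) {m n : ℕ} (hmn : m.Coprime n) :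
    (pairRoots h (m * n)).card = (pairRoots h m).card * (pairRoots h n).card := by
  rcases Nat.eq_zero_or_pos m with rfl | hm
  · simp [pairRoots]
  rcases Nat.eq_zero_or_pos n with rfl | hn
  · simp [pairRoots]
  have : NeZero m := ⟨hm.ne'⟩
  have : NeZero n := ⟨hn.ne'⟩
  rw [card_pairRoots_eq, card_pairRoots_eq, card_pairRoots_eq, ← Nat.card_prod]
  let e := ZMod.chineseRemainder hmn
  refine Nat.card_congr ⟨fun x => (⟨(e x.1).1, ?_⟩, ⟨(e x.1).2, ?_⟩),
    fun y => ⟨e.symm (y.1.1, y.2.1), ?_⟩, ?_, ?_⟩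
  · have := congrArg (fun t => (e t).1) x.2
    simpa using this
  · have := congrArg (fun t => (e t).2) x.2
    simpa using this
  · apply e.injective
    have h1 := y.1.2
    have h2 := y.2.2
    ext <;> simp [h1, h2]
  · intro x; simp
  · intro y; simp

theorem card_pairRoots_prime_of_dvd {h p : ℕ} (hp : p.Prime) (hph : p ∣ h) :
    (pairRoots h p).card = 1 := by
  rw [Finset.card_eq_one]
  refine ⟨0, Finset.ext fun v => ?_⟩
  simp only [pairRoots, Finset.mem_filter, Finset.mem_range, Finset.mem_singleton]
  constructor
  · rintro ⟨h1, h2⟩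
    have h3 : p ∣ v := by
      rcases (Nat.Prime.dvd_mul hp).1 h2 with h3 | h3
      · exact h3
      · exact (Nat.dvd_add_left hph).1 h3
    exact Nat.eq_zero_of_dvd_of_lt h3 h1
  · rintro rfl
    simp [hp.pos]

theorem card_pairRoots_prime_of_not_dvd {h p : ℕ} (hp : p.Prime) (hph : ¬ p ∣ h) :
    (pairRoots h p).card = 2 := by
  rw [Finset.card_eq_two]
  have hmod : h % p < p := Nat.mod_lt _ hp.pos
  have hmod0 : h % p ≠ 0 := fun h0 => hph (Nat.dvd_of_mod_eq_zero h0)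
  refine ⟨0, p - h % p, by omega, Finset.ext fun v => ?_⟩
  simp only [pairRoots, Finset.mem_filter, Finset.mem_range, Finset.mem_insert,
    Finset.mem_singleton]
  have key : p ∣ v + h ↔ p ∣ v + h % p := by
    rw [Nat.dvd_iff_mod_eq_zero, Nat.dvd_iff_mod_eq_zero, Nat.add_mod_mod]
  constructor
  · rintro ⟨h1, h2⟩
    rcases (Nat.Prime.dvd_mul hp).1 h2 with h3 | h3
    · exact Or.inl (Nat.eq_zero_of_dvd_of_lt h3 h1)
    · right
      obtain ⟨k, hk⟩ := key.1 h3
      have : k = 1 := by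
        have h4 : 0 < p * k := by omega
        have h5 : p * k < p * 2 := by omega
        have := Nat.pos_of_mul_pos_left h4
        have := Nat.lt_of_mul_lt_mul_left h5
        have := Nat.pos_of_ne_zero (n := k) (by rintro rfl; simp at h4)
        omega
      subst this; omega
  · rintro (rfl | rfl)
    · simp [hp.pos]
    · refine ⟨by omega, Dvd.dvd.mul_left (key.2 ⟨1, by omega⟩) _⟩

/-- Each root class modulo d meets [0, N) in N/d + O(1) integers with error at most 1, and there are
at most d roots. -/
theorem abs_card_filter_pair_sub_le (h N : ℕ) {d : ℕ} (hd : 0 < d) :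
    |(((Finset.range N).filter fun n => d ∣ n * (n + h)).card : ℝ) -
      (pairRoots h d).card / d * N| ≤ d := by
  have hd0 : (0 : ℝ) < d := by exact_mod_cast hd
  have hcount : ∀ v ∈ pairRoots h d,
      |(((Finset.range N).filter fun n => n % d = v).card : ℝ) - N / d| ≤ 1 := by
    intro v hv
    have hvd : v < d := Finset.mem_range.1 (Finset.mem_filter.1 hv).1
    have h1 : ((Finset.range N).filter fun n => n % d = v).card = Nat.count (· ≡ v [MOD d]) N := by
      rw [Nat.count_eq_card_filter_range]
      congr 1
      apply Finset.filter_congr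
      intro n _
      rw [Nat.ModEq, Nat.mod_eq_of_lt hvd]
    rw [h1, Nat.count_modEq_card _ hd]
    have h2 : ((N / d : ℕ) : ℝ) ≤ N / d := Nat.cast_div_le
    have h3 : (N : ℝ) / d < (N / d : ℕ) + 1 := by
      rw [← Nat.floor_div_eq_div (K := ℝ)]
      exact Nat.lt_floor_add_one _
    rw [abs_le]
    split_ifs <;> push_cast <;> constructor <;> linarith
  have hfib : ((Finset.range N).filter fun n => d ∣ n * (n + h)).card =
      ∑ v ∈ pairRoots h d, ((Finset.range N).filter fun n => n % d = v).card := by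
    rw [Finset.card_eq_sum_card_fiberwise (f := fun n => n % d) (t := pairRoots h d)]
    · apply Finset.sum_congr rfl
      intro v hv
      rw [Finset.filter_filter]
      congr 1
      apply Finset.filter_congr
      rintro n _
      constructor
      · exact fun h => h.2
      · rintro rfl
        refine ⟨?_, rfl⟩
        have := (Finset.mem_filter.1 hv).2
        rw [Nat.dvd_iff_mod_eq_zero] at this ⊢
        simpa [Nat.mul_mod, Nat.add_mod] using this
    · intro n hn
      have := (Finset.mem_filter.1 hn).2
      simp only [pairRoots, Finset.coe_filter, Finset.mem_range, Set.mem_ofPred_eq]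
      refine ⟨Nat.mod_lt _ hd, ?_⟩
      rw [Nat.dvd_iff_mod_eq_zero] at this ⊢
      simpa [Nat.mul_mod, Nat.add_mod] using this
  have h4 : (((Finset.range N).filter fun n => d ∣ n * (n + h)).card : ℝ) -
      (pairRoots h d).card / d * N = ∑ v ∈ pairRoots h d,
        ((((Finset.range N).filter fun n => n % d = v).card : ℝ) - N / d) := by
    rw [hfib, Finset.sum_sub_distrib, Finset.sum_const, nsmul_eq_mul]
    push_cast
    ring
  rw [h4]
  calc _ ≤ ∑ v ∈ pairRoots h d,
        |(((Finset.range N).filter fun n => n % d = v).card : ℝ) - N / d| :=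
        Finset.abs_sum_le_sum_abs _ _
    _ ≤ ∑ v ∈ pairRoots h d, (1 : ℝ) := Finset.sum_le_sum hcount
    _ = (pairRoots h d).card := by simp
    _ ≤ d := by exact_mod_cast card_pairRoots_le h d

/-- The density of the residues `v` modulo `d` with `v (v + h) ≡ 0`. -/
noncomputable def pairDensity (h : ℕ) : ArithmeticFunction ℝ :=
  ⟨fun d => (pairRoots h d).card / d, by simp⟩

theorem pairDensity_apply (h d : ℕ) : pairDensity h d = (pairRoots h d).card / d := rfl

theorem isMultiplicative_pairDensity (h : ℕ) : (pairDensity h).IsMultiplicative := by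
  constructor
  · simp [pairDensity_apply, pairRoots]
  · intro m n hmn
    simp only [pairDensity_apply, card_pairRoots_mul h hmn]
    push_cast
    rw [mul_div_mul_comm]

/-- The product of the odd primes up to `z`. -/
def oddPrimorial (z : ℕ) : ℕ := ∏ p ∈ (Nat.primesLE z).erase 2, p

theorem prime_of_mem_primesLE_erase {z p : ℕ} (hp : p ∈ (Nat.primesLE z).erase 2) : p.Prime :=
  Nat.prime_of_mem_primesLE (Finset.mem_of_mem_erase hp)

theorem squarefree_oddPrimorial (z : ℕ) : Squarefree (oddPrimorial z) := by
  apply Finset.squarefree_prod_of_pairwise_isCoprime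
  · intro p hp q hq hpq
    rw [Function.onFun, ← Nat.coprime_iff_isRelPrime]
    exact (Nat.coprime_primes (prime_of_mem_primesLE_erase hp)
      (prime_of_mem_primesLE_erase hq)).2 hpq
  · intro p hp
    exact (prime_of_mem_primesLE_erase hp).prime.squarefree

theorem prime_dvd_oddPrimorial {z p : ℕ} (hp : p.Prime) :
    p ∣ oddPrimorial z ↔ p ≠ 2 ∧ p ≤ z := by
  rw [oddPrimorial, hp.prime.dvd_finsetProd_iff]
  constructor
  · rintro ⟨q, hq, hpq⟩
    rw [(Nat.prime_dvd_prime_iff_eq hp (prime_of_mem_primesLE_erase hq)).1 hpq]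
    simp only [Finset.mem_erase, Nat.mem_primesLE] at hq
    exact ⟨hq.1, hq.2.1⟩
  · rintro ⟨h1, h2⟩
    exact ⟨p, by simp [Nat.mem_primesLE, h1, h2, hp], dvd_rfl⟩

/-- The sieve problem for pairs of primes with difference `h`. -/
noncomputable def pairSieve (h N z : ℕ) : BoundingSieve where
  support := (Finset.range N).image fun n => n * (n + h)
  prodPrimes := oddPrimorial z
  prodPrimes_squarefree := squarefree_oddPrimorial z
  weights := fun _ => 1
  weights_nonneg := fun _ => zero_le_one
  totalMass := N
  nu := pairDensity h
  nu_mult := isMultiplicative_pairDensity h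
  nu_pos_of_prime := fun p hp _ => by
    rw [pairDensity_apply]
    have h1 : 0 < (pairRoots h p).card := Finset.card_pos.2 ⟨0, zero_mem_pairRoots h hp.pos⟩
    have h2 := hp.pos
    positivity
  -- This is why 2 is not sifted: for odd h both residues modulo 2 are roots, and the density would
  -- be 1.
  nu_lt_one_of_prime := fun p hp hpz => by
    have h2 := ((prime_dvd_oddPrimorial hp).1 hpz).1
    have h3 := hp.two_le
    have h4 : (pairRoots h p).card < p := by
      by_cases hph : p ∣ h
      · rw [card_pairRoots_prime_of_dvd hp hph]; omega
      · rw [card_pairRoots_prime_of_not_dvd hp hph]; omega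
    rw [pairDensity_apply, div_lt_one (by exact_mod_cast hp.pos)]
    exact_mod_cast h4

theorem mul_add_injective (h : ℕ) : Function.Injective fun n : ℕ => n * (n + h) := by
  apply StrictMono.injective
  intro a b hab
  exact Nat.mul_lt_mul'' hab (by omega)

theorem pairSieve_rem_le (h N z : ℕ) {d : ℕ} (hd : 0 < d) : |(pairSieve h N z).rem d| ≤ d := by
  convert abs_card_filter_pair_sub_le h N hd using 2
  rw [BoundingSieve.rem, BoundingSieve.multSum]
  congr 1
  simp only [pairSieve]
  rw [Finset.sum_image (fun a _ b _ hab => mul_add_injective h hab)]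
  simp

theorem pairSieve_nu_inv_le (h N z : ℕ) {d : ℕ} (hd : 0 < d) :
    ((pairSieve h N z).nu d)⁻¹ ≤ d := by
  have h1 : 1 ≤ (pairRoots h d).card := Finset.card_pos.2 ⟨0, zero_mem_pairRoots h hd⟩
  change (pairDensity h d)⁻¹ ≤ d
  rw [pairDensity_apply, inv_div]
  apply div_le_self (by positivity)
  exact_mod_cast h1

/-- A pair with p > z survives the sieve, as neither prime divides `oddPrimorial z`; the term z + 1
pays for p ≤ z. -/
theorem card_prime_pairs_le_siftedSum (h N z : ℕ) :
    (((Finset.range N).filter fun p => p.Prime ∧ (p + h).Prime).card : ℝ) ≤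
      z + 1 + (pairSieve h N z).siftedSum := by
  have h1 : ((Finset.range N).filter fun p => p.Prime ∧ (p + h).Prime) ⊆
      Finset.range (z + 1) ∪
        (Finset.range N).filter fun n => (oddPrimorial z).Coprime (n * (n + h)) := by
    intro p hp
    simp only [Finset.mem_filter, Finset.mem_range, Finset.mem_union] at hp ⊢
    by_cases hpz : p < z + 1
    · exact Or.inl hpz
    · refine Or.inr ⟨hp.1, Nat.Coprime.symm (Nat.Coprime.mul_left ?_ ?_)⟩
      · rw [hp.2.1.coprime_iff_not_dvd, prime_dvd_oddPrimorial hp.2.1]; omega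
      · rw [hp.2.2.coprime_iff_not_dvd, prime_dvd_oddPrimorial hp.2.2]; omega
  have h2 := (Finset.card_le_card h1).trans (Finset.card_union_le _ _)
  have h3 : (pairSieve h N z).siftedSum =
      ((Finset.range N).filter fun n => (oddPrimorial z).Coprime (n * (n + h))).card := by
    calc _ = ∑ m ∈ (Finset.range N).image fun n => n * (n + h),
          if (oddPrimorial z).Coprime m then (1 : ℝ) else 0 := rfl
      _ = _ := by
        rw [Finset.sum_image (fun a _ b _ hab => mul_add_injective h hab), Finset.sum_boole]
  rw [h3]
  rw [Finset.card_range] at h2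
  exact_mod_cast h2

theorem card_prime_pairs_le (h N : ℕ) {z : ℕ} (hz : 1 ≤ z) :
    (((Finset.range N).filter fun p => p.Prime ∧ (p + h).Prime).card : ℝ) ≤
      N / (pairSieve h N z).selbergSum z + (z + 1 + (z : ℝ) ^ 8) := by
  have hpos : ∀ d, d ∣ (pairSieve h N z).prodPrimes → 0 < d := fun d hd =>
    Nat.pos_of_ne_zero (ne_zero_of_dvd_ne_zero BoundingSieve.prodPrimes_ne_zero hd)
  have h1 := (pairSieve h N z).siftedSum_le_totalMass_div_selbergSum hz
    (fun d hd => pairSieve_nu_inv_le h N z (hpos d hd))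
    (fun d hd => pairSieve_rem_le h N z (hpos d hd))
  have h2 := card_prime_pairs_le_siftedSum h N z
  have h3 : (pairSieve h N z).totalMass = N := rfl
  rw [h3] at h1
  linarith

/-! ### A lower bound for the Selberg sum. -/

/-- Expanding the product gives one nonnegative term for each exponent vector on s, and n is
determined by its exponents, which lie in [1, m]. -/
theorem ArithmeticFunction.IsMultiplicative.sum_le_prod_sum_prime_pow {F : ArithmeticFunction ℝ}
    (hF : F.IsMultiplicative) (hF0 : ∀ n, 0 ≤ F n) (s T : Finset ℕ) (m : ℕ)
    (hT : ∀ n ∈ T, n ≠ 0 ∧ n ≤ m ∧ n.primeFactors = s) :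
    ∑ n ∈ T, F n ≤ ∏ p ∈ s, ∑ k ∈ Finset.Icc 1 m, F (p ^ k) := by
  rw [Finset.prod_sum]
  have hinj : Set.InjOn (fun (n : ℕ) (p : ℕ) (_ : p ∈ s) => n.factorization p) T := by
    intro a ha b hb hab
    obtain ⟨ha0, -, has⟩ := hT a ha
    obtain ⟨hb0, -, hbs⟩ := hT b hb
    refine Nat.eq_of_factorization_eq ha0 hb0 fun p => ?_
    by_cases hp : p ∈ s
    · exact congrFun (congrFun hab p) hp
    · rw [Finsupp.notMem_support_iff.1 (by rwa [Nat.support_factorization, has]),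
        Finsupp.notMem_support_iff.1 (by rwa [Nat.support_factorization, hbs])]
  calc ∑ n ∈ T, F n = ∑ n ∈ T, ∏ p ∈ s.attach, F (p.1 ^ n.factorization p.1) := by
        apply Finset.sum_congr rfl
        intro n hn
        obtain ⟨hn0, -, hns⟩ := hT n hn
        rw [hF.multiplicative_factorization _ hn0, Finsupp.prod, Nat.support_factorization, hns,
          ← Finset.prod_attach]
    _ = ∑ e ∈ T.image (fun (n : ℕ) (p : ℕ) (_ : p ∈ s) => n.factorization p),
          ∏ p ∈ s.attach, F (p.1 ^ e p.1 p.2) := by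
        rw [Finset.sum_image hinj]
    _ ≤ _ := by
        apply Finset.sum_le_sum_of_subset_of_nonneg
        · intro e he
          obtain ⟨n, hn, rfl⟩ := Finset.mem_image.1 he
          obtain ⟨hn0, hnm, hns⟩ := hT n hn
          rw [Finset.mem_pi]
          intro p hp
          rw [← hns] at hp
          have hp' := Nat.mem_primeFactors.1 hp
          refine Finset.mem_Icc.2 ⟨(hp'.1.factorization_pos_of_dvd hn0 hp'.2.1), ?_⟩
          exact ((Nat.factorization_lt p hn0).le).trans hnm
        · intro _ _ _
          exact Finset.prod_nonneg fun _ _ => hF0 _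

/-- The function `n ↦ 1 / n` restricted to the integers coprime to `m`. -/
noncomputable def coprimeInv (m : ℕ) : ArithmeticFunction ℝ :=
  ⟨fun n => if n.Coprime m then (n : ℝ)⁻¹ else 0, by simp⟩

theorem coprimeInv_apply (m n : ℕ) :
    coprimeInv m n = if n.Coprime m then (n : ℝ)⁻¹ else 0 := rfl

theorem coprimeInv_nonneg (m n : ℕ) : 0 ≤ coprimeInv m n := by
  rw [coprimeInv_apply]; positivity

theorem isMultiplicative_coprimeInv (m : ℕ) : (coprimeInv m).IsMultiplicative := by
  constructor
  · simp [coprimeInv_apply]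
  · intro a b _
    simp only [coprimeInv_apply, Nat.coprime_mul_iff_left]
    split_ifs <;> first | tauto | simp [mul_comm]

theorem coprimeInv_prime_pow_le {m p : ℕ} (k : ℕ) :
    coprimeInv m (p ^ k) ≤ ((p : ℝ)⁻¹) ^ k := by
  rw [coprimeInv_apply]
  split_ifs
  · simp
  · positivity

/-- If p ∣ h, only the factorisation p^k · 1 can contribute. Otherwise there are k + 1 ≤ 2^k
factorisations, each worth at most p^{−k}, against (2/p)^k. -/
theorem coprimeInv_mul_prime_pow_le {h p k : ℕ} (hp : p.Prime) :
    (coprimeInv 2 * coprimeInv (2 * h)) (p ^ k) ≤ pairDensity h p ^ k := by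
  rw [ArithmeticFunction.mul_apply, Nat.sum_divisorsAntidiagonal
    (fun a b => coprimeInv 2 a * coprimeInv (2 * h) b), Nat.sum_divisors_prime_pow hp]
  have hp0 : (0 : ℝ) < p := by exact_mod_cast hp.pos
  have hdiv : ∀ i ∈ Finset.range (k + 1), p ^ k / p ^ i = p ^ (k - i) := fun i hi =>
    Nat.pow_div (by simpa [Nat.lt_succ_iff] using hi) hp.pos
  have hle : ∀ i ∈ Finset.range (k + 1),
      coprimeInv 2 (p ^ i) * coprimeInv (2 * h) (p ^ k / p ^ i) ≤ ((p : ℝ)⁻¹) ^ k := by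
    intro i hi
    rw [hdiv i hi]
    calc _ ≤ ((p : ℝ)⁻¹) ^ i * ((p : ℝ)⁻¹) ^ (k - i) := by
          gcongr
          · exact coprimeInv_nonneg _ _
          · exact coprimeInv_prime_pow_le _
          · exact coprimeInv_prime_pow_le _
      _ = _ := by
          rw [← pow_add]
          congr 1
          have := Finset.mem_range.1 hi
          omega
  rw [pairDensity_apply]
  by_cases hph : p ∣ h
  · rw [card_pairRoots_prime_of_dvd hp hph, Finset.sum_eq_single_of_mem k (by simp)]
    · simpa using hle k (by simp)
    · intro i hi hik
      have hlt : i < k := by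
        have := Finset.mem_range.1 hi
        omega
      rw [hdiv i hi, coprimeInv_apply (2 * h), if_neg, mul_zero]
      intro hc
      have h1 : p ∣ Nat.gcd (p ^ (k - i)) (2 * h) :=
        Nat.dvd_gcd (dvd_pow_self p (by omega)) (Dvd.dvd.mul_left hph 2)
      rw [hc] at h1
      exact hp.one_lt.ne' (Nat.dvd_one.1 h1)
  · rw [card_pairRoots_prime_of_not_dvd hp hph]
    calc _ ≤ ∑ i ∈ Finset.range (k + 1), ((p : ℝ)⁻¹) ^ k := Finset.sum_le_sum hle
      _ = ((k + 1 : ℕ) : ℝ) * ((p : ℝ)⁻¹) ^ k := by simp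
      _ ≤ ((2 ^ k : ℕ) : ℝ) * ((p : ℝ)⁻¹) ^ k := by
          gcongr
          exact Nat.lt_two_pow_self
      _ = _ := by push_cast; rw [div_eq_mul_inv, mul_pow]

theorem coprimeInv_mul_eq_zero_of_even {h n : ℕ} (hn : 2 ∣ n) :
    (coprimeInv 2 * coprimeInv (2 * h)) n = 0 := by
  rw [ArithmeticFunction.mul_apply]
  apply Finset.sum_eq_zero
  rintro ⟨a, b⟩ hab
  rw [Nat.mem_divisorsAntidiagonal] at hab
  rw [← hab.1] at hn
  rcases (Nat.Prime.dvd_mul Nat.prime_two).1 hn with h2 | h2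
  · simp only [coprimeInv_apply]
    rw [if_neg, zero_mul]
    intro hc
    have := Nat.dvd_gcd h2 (dvd_refl 2)
    rw [hc] at this
    omega
  · simp only [coprimeInv_apply _ b]
    rw [if_neg, mul_zero]
    intro hc
    have := Nat.dvd_gcd h2 (dvd_mul_right 2 h)
    rw [hc] at this
    omega

theorem sum_Icc_pow_le {r : ℝ} (h0 : 0 ≤ r) (h1 : r < 1) (m : ℕ) :
    ∑ k ∈ Finset.Icc 1 m, r ^ k ≤ r * (1 - r)⁻¹ := by
  have h2 : ∑ k ∈ Finset.Icc 1 m, r ^ k = r * ∑ k ∈ Finset.range m, r ^ k := by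
    induction m with
    | zero => simp
    | succ m ih => rw [Finset.sum_Icc_succ_top (by omega), ih, Finset.sum_range_succ]; ring
  rw [h2]
  gcongr
  rw [← tsum_geometric_of_lt_one h0 h1]
  exact (summable_geometric_of_lt_one h0 h1).sum_le_tsum _ (by intros; positivity)

/-- Group the odd n ≤ z by their radical l. The Selberg term at l is ∏ ν(p)/(1 − ν(p)), a product of
full geometric series ∑_{k ≥ 1} ν(p)^k, which dominates the sum over all n with radical l. -/
theorem sum_coprimeInv_mul_le_selbergSum (h N z : ℕ) :
    ∑ n ∈ Finset.Icc 1 z, (coprimeInv 2 * coprimeInv (2 * h)) n ≤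
      (pairSieve h N z).selbergSum z := by
  set F := coprimeInv 2 * coprimeInv (2 * h) with hFdef
  have hF : F.IsMultiplicative :=
    (isMultiplicative_coprimeInv 2).mul (isMultiplicative_coprimeInv (2 * h))
  have hF0 : ∀ n, 0 ≤ F n := fun n => by
    rw [hFdef, ArithmeticFunction.mul_apply]
    exact Finset.sum_nonneg fun _ _ => mul_nonneg (coprimeInv_nonneg _ _) (coprimeInv_nonneg _ _)
  set P := oddPrimorial z
  have hP0 : P ≠ 0 := (squarefree_oddPrimorial z).ne_zero
  calc ∑ n ∈ Finset.Icc 1 z, F n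
      = ∑ n ∈ Finset.Icc 1 z with ¬ 2 ∣ n, F n := by
        symm
        apply Finset.sum_filter_of_ne
        intro n _ hn h2
        exact hn (coprimeInv_mul_eq_zero_of_even h2)
    _ = ∑ l ∈ P.divisors with l ≤ z, ∑ n ∈ (Finset.Icc 1 z).filter (¬ 2 ∣ ·) with
          ∏ p ∈ n.primeFactors, p = l, F n := by
        symm
        apply Finset.sum_fiberwise_of_maps_to
        intro n hn
        simp only [Finset.mem_filter, Finset.mem_Icc, Nat.mem_divisors] at hn ⊢
        refine ⟨⟨?_, hP0⟩, (Nat.le_of_dvd hn.1.1 (Nat.prod_primeFactors_dvd n)).trans hn.1.2⟩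
        apply Finset.prod_dvd_prod_of_subset
        intro p hp
        have hp' := Nat.mem_primeFactors.1 hp
        rw [Finset.mem_erase, Nat.mem_primesLE]
        exact ⟨fun h => hn.2 (h ▸ hp'.2.1), (Nat.le_of_dvd hn.1.1 hp'.2.1).trans hn.1.2, hp'.1⟩
    _ ≤ ∑ l ∈ P.divisors with l ≤ z, (pairSieve h N z).selbergTerms l := by
        apply Finset.sum_le_sum
        intro l hl
        rw [Finset.mem_filter, Nat.mem_divisors] at hl
        refine (hF.sum_le_prod_sum_prime_pow hF0 l.primeFactors _ z ?_).trans ?_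
        · intro n hn
          simp only [Finset.mem_filter, Finset.mem_Icc] at hn
          refine ⟨by omega, hn.1.1.2, ?_⟩
          rw [← hn.2, Nat.primeFactors_prod fun p hp => Nat.prime_of_mem_primeFactors hp]
        · rw [BoundingSieve.selbergTerms_apply, ← BoundingSieve.prod_primeFactors_nu hl.1.1,
            ← Finset.prod_mul_distrib]
          apply Finset.prod_le_prod
          · intro p _
            exact Finset.sum_nonneg fun _ _ => hF0 _
          · intro p hp
            have hp' := Nat.mem_primeFactors.1 hp
            have hpP := hp'.2.1.trans hl.1.1
            refine (Finset.sum_le_sum fun k _ => coprimeInv_mul_prime_pow_le hp'.1).trans ?_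
            exact sum_Icc_pow_le ((pairSieve h N z).nu_pos_of_prime p hp'.1 hpP).le
              ((pairSieve h N z).nu_lt_one_of_prime p hp'.1 hpP) z
    _ = _ := rfl

theorem sum_mul_sum_coprimeInv_le {h w z : ℕ} (hw : w ^ 2 ≤ z) :
    (∑ a ∈ Finset.Icc 1 w, coprimeInv 2 a) * (∑ b ∈ Finset.Icc 1 w, coprimeInv (2 * h) b) ≤
      ∑ n ∈ Finset.Icc 1 z, (coprimeInv 2 * coprimeInv (2 * h)) n := by
  rw [Finset.sum_mul_sum, ← Finset.sum_product',
    ← Finset.sum_fiberwise_of_maps_to (t := Finset.Icc 1 z) (g := fun x : ℕ × ℕ => x.1 * x.2)]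
  · apply Finset.sum_le_sum
    intro n hn
    rw [ArithmeticFunction.mul_apply]
    apply Finset.sum_le_sum_of_subset_of_nonneg
    · rintro ⟨a, b⟩ hab
      rw [Finset.mem_filter] at hab
      rw [Nat.mem_divisorsAntidiagonal]
      exact ⟨hab.2, by have := Finset.mem_Icc.1 hn; omega⟩
    · intro _ _ _
      exact mul_nonneg (coprimeInv_nonneg _ _) (coprimeInv_nonneg _ _)
  · rintro ⟨a, b⟩ hab
    simp only [Finset.mem_product, Finset.mem_Icc] at hab ⊢
    refine ⟨Nat.mul_pos hab.1.1 hab.2.1, ?_⟩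
    calc a * b ≤ w * w := Nat.mul_le_mul hab.1.2 hab.2.2
      _ ≤ z := by rwa [← sq]

/-- Induction on s: a multiple q·b in the sifted set A has b in A too, so removing the multiples of
q loses at most the fraction 1/q of the sum. -/
theorem prod_one_sub_inv_mul_harmonic_le (s : Finset ℕ) (hs : ∀ p ∈ s, p.Prime) (w : ℕ) :
    (∏ p ∈ s, (1 - (p : ℝ)⁻¹)) * ∑ a ∈ Finset.Icc 1 w, (a : ℝ)⁻¹ ≤
      ∑ a ∈ Finset.Icc 1 w with ∀ p ∈ s, ¬ p ∣ a, (a : ℝ)⁻¹ := by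
  induction s using Finset.induction_on with
  | empty => simp
  | insert q s hq ih =>
    have hqp := hs q (Finset.mem_insert_self q s)
    have hsp : ∀ p ∈ s, p.Prime := fun p hp => hs p (Finset.mem_insert_of_mem hp)
    have hq1 : (1 : ℝ) ≤ q := by exact_mod_cast hqp.one_lt.le
    have hqi : (0 : ℝ) ≤ 1 - (q : ℝ)⁻¹ := sub_nonneg.2 (inv_le_one_of_one_le₀ hq1)
    rw [Finset.prod_insert hq, mul_assoc]
    refine (mul_le_mul_of_nonneg_left (ih hsp) hqi).trans ?_
    set A := (Finset.Icc 1 w).filter fun a => ∀ p ∈ s, ¬ p ∣ a with hA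
    have h1 : ∑ a ∈ A with q ∣ a, (a : ℝ)⁻¹ ≤ (q : ℝ)⁻¹ * ∑ a ∈ A, (a : ℝ)⁻¹ := by
      have hsub : A.filter (q ∣ ·) ⊆ A.image (q * ·) := by
        intro a ha
        simp only [hA, Finset.mem_filter, Finset.mem_Icc, Finset.mem_image] at ha ⊢
        obtain ⟨⟨⟨h1, h2⟩, h3⟩, b, rfl⟩ := ha
        refine ⟨b, ⟨⟨Nat.pos_of_mul_pos_left h1, ?_⟩, fun p hp hpb =>
          h3 p hp (hpb.mul_left q)⟩, rfl⟩
        exact (Nat.le_mul_of_pos_left b hqp.pos).trans h2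
      calc _ ≤ ∑ a ∈ A.image (q * ·), (a : ℝ)⁻¹ :=
            Finset.sum_le_sum_of_subset_of_nonneg hsub (by intros; positivity)
        _ = ∑ a ∈ A, ((q * a : ℕ) : ℝ)⁻¹ :=
            Finset.sum_image fun a _ b _ hab => Nat.eq_of_mul_eq_mul_left hqp.pos hab
        _ = _ := by
            rw [Finset.mul_sum]
            apply Finset.sum_congr rfl
            intro a _
            push_cast
            rw [mul_inv]
    have h2 : (Finset.Icc 1 w).filter (fun a => ∀ p ∈ insert q s, ¬ p ∣ a) =
        A.filter (¬ q ∣ ·) := by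
      ext a
      simp only [hA, Finset.mem_filter, Finset.forall_mem_insert]
      tauto
    rw [h2]
    have h3 := Finset.sum_filter_add_sum_filter_not A (q ∣ ·) (fun a => (a : ℝ)⁻¹)
    linarith

theorem prod_one_sub_inv_mul_log_le_sum_coprimeInv {m : ℕ} (hm : m ≠ 0) {w : ℕ} (hw : 1 ≤ w) :
    (∏ p ∈ m.primeFactors, (1 - (p : ℝ)⁻¹)) * Real.log w ≤
      ∑ a ∈ Finset.Icc 1 w, coprimeInv m a := by
  have h1 := prod_one_sub_inv_mul_harmonic_le m.primeFactors
    (fun p hp => Nat.prime_of_mem_primeFactors hp) w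
  have h2 : Real.log w ≤ ∑ a ∈ Finset.Icc 1 w, (a : ℝ)⁻¹ := by
    have h3 := log_add_one_le_harmonic w
    rw [harmonic_eq_sum_Icc] at h3
    push_cast at h3
    refine (Real.log_le_log (by exact_mod_cast hw) ?_).trans h3
    linarith
  have h4 : ∑ a ∈ Finset.Icc 1 w, coprimeInv m a =
      ∑ a ∈ Finset.Icc 1 w with ∀ p ∈ m.primeFactors, ¬ p ∣ a, (a : ℝ)⁻¹ := by
    rw [Finset.sum_filter]
    apply Finset.sum_congr rfl
    intro a _
    rw [coprimeInv_apply]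
    congr 1
    rw [eq_iff_iff]
    constructor
    · intro hc p hp hpa
      have hp' := Nat.mem_primeFactors.1 hp
      exact Nat.not_coprime_of_dvd_of_dvd hp'.1.one_lt hpa hp'.2.1 hc
    · intro hc
      exact Nat.coprime_of_dvd fun p hp hpa hpm => hc p (Nat.mem_primeFactors.2 ⟨hp, hpm, hm⟩) hpa
  rw [h4]
  refine le_trans ?_ h1
  gcongr
  apply Finset.prod_nonneg
  intro p hp
  have : (1 : ℝ) ≤ p := by exact_mod_cast (Nat.prime_of_mem_primeFactors hp).one_lt.le
  exact sub_nonneg.2 (inv_le_one_of_one_le₀ this)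

/-- The ratio `n / φ(n)`, written as a product over the prime factors of `n`. -/
noncomputable def totientRatio (n : ℕ) : ℝ := ∏ p ∈ n.primeFactors, (1 - (p : ℝ)⁻¹)⁻¹

theorem one_le_inv_one_sub_inv {p : ℕ} (hp : p.Prime) : 1 ≤ (1 - (p : ℝ)⁻¹)⁻¹ := by
  have h1 : (1 : ℝ) < p := by exact_mod_cast hp.one_lt
  have h2 : (p : ℝ)⁻¹ < 1 := inv_lt_one_of_one_lt₀ h1
  have h3 : 0 < (p : ℝ)⁻¹ := by positivity
  exact (one_le_inv₀ (by linarith)).2 (by linarith)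

theorem one_le_totientRatio (n : ℕ) : 1 ≤ totientRatio n := by
  calc (1 : ℝ) = ∏ _p ∈ n.primeFactors, 1 := by simp
    _ ≤ _ := Finset.prod_le_prod (fun _ _ => zero_le_one)
      fun _ hp => one_le_inv_one_sub_inv (Nat.prime_of_mem_primeFactors hp)

/-- Each of the two coprime harmonic sums gives a factor log w and loses at most 1/2 to the prime 2,
whence the 4; the second also loses the primes of h. -/
theorem le_selbergSum_pairSieve {h N w z : ℕ} (hh : h ≠ 0) (hw : 1 ≤ w) (hwz : w ^ 2 ≤ z) :
    Real.log w ^ 2 / (4 * totientRatio h) ≤ (pairSieve h N z).selbergSum z := by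
  refine le_trans ?_ ((sum_mul_sum_coprimeInv_le hwz).trans
    (sum_coprimeInv_mul_le_selbergSum h N z))
  have hlog : 0 ≤ Real.log w := Real.log_natCast_nonneg w
  have h1 := prod_one_sub_inv_mul_log_le_sum_coprimeInv (m := 2) (by norm_num) hw
  have h2 := prod_one_sub_inv_mul_log_le_sum_coprimeInv (m := 2 * h) (by simpa using hh) hw
  have hG := one_le_totientRatio h
  have h3 : (2 : ℝ)⁻¹ * (totientRatio h)⁻¹ ≤ ∏ p ∈ (2 * h).primeFactors, (1 - (p : ℝ)⁻¹) := by
    have hinv : (totientRatio h)⁻¹ = ∏ p ∈ h.primeFactors, (1 - (p : ℝ)⁻¹) := by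
      rw [totientRatio, Finset.prod_inv_distrib, inv_inv]
    rw [hinv, Nat.primeFactors_mul (by norm_num) hh, Nat.prime_two.primeFactors]
    by_cases h2h : 2 ∈ h.primeFactors
    · rw [Finset.union_eq_right.2 (by simpa using h2h)]
      have h0 : 0 ≤ ∏ p ∈ h.primeFactors, (1 - (p : ℝ)⁻¹) := by
        rw [← hinv]; positivity
      linarith
    · rw [Finset.prod_union (by simpa using h2h)]
      norm_num
  have h4 : (2 : ℝ)⁻¹ * Real.log w ≤ ∑ a ∈ Finset.Icc 1 w, coprimeInv 2 a := by
    rw [Nat.prime_two.primeFactors] at h1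
    norm_num at h1 ⊢
    exact h1
  calc _ = ((2 : ℝ)⁻¹ * Real.log w) * ((2 : ℝ)⁻¹ * (totientRatio h)⁻¹ * Real.log w) := by
        field_simp; ring
    _ ≤ _ := by
        have h5 : 0 ≤ (2 : ℝ)⁻¹ * Real.log w := by positivity
        exact mul_le_mul h4 ((mul_le_mul_of_nonneg_right h3 hlog).trans h2) (by positivity)
          (h5.trans h4)

/-! ### The upper bound for prime pairs, uniform in h. -/

theorem exists_card_prime_pairs_le : ∃ C : ℝ, 0 < C ∧ ∃ N₀ : ℕ, ∀ N : ℕ, N₀ ≤ N → ∀ h : ℕ, h ≠ 0 →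
    (((Finset.range N).filter fun p => p.Prime ∧ (p + h).Prime).card : ℝ) ≤
      C * N / Real.log N ^ 2 * totientRatio h := by
  refine ⟨4 * 64 ^ 2 + 48, by norm_num, 2 ^ 64, fun N hN h hh => ?_⟩
  have hN1 : (2 : ℝ) ^ 64 ≤ N := by exact_mod_cast hN
  have hN0 : (0 : ℝ) < N := lt_of_lt_of_le (by norm_num) hN1
  have hlog : 0 < Real.log N := Real.log_pos (lt_of_lt_of_le (by norm_num) hN1)
  have hG := one_le_totientRatio h
  -- The sieve level is z = w² ≤ y⁴ = N^{1/16}, so the error z⁸ is at most N^{1/2}. The threshold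
  -- 2^64 gives y ≥ 2, hence w ≥ y² − 1 ≥ y.
  set y : ℝ := (N : ℝ) ^ (1 / 64 : ℝ) with hy
  have hy0 : 0 < y := Real.rpow_pos_of_pos hN0 _
  have hy64 : y ^ 64 = N := by
    rw [hy, ← Real.rpow_natCast, ← Real.rpow_mul hN0.le]; norm_num
  have hy2 : 2 ≤ y := by
    rw [← hy64] at hN1
    exact (pow_le_pow_iff_left₀ (by norm_num) hy0.le (by norm_num)).1 hN1
  set w : ℕ := ⌊y ^ 2⌋₊ with hw
  have hwle : (w : ℝ) ≤ y ^ 2 := Nat.floor_le (by positivity)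
  have hwge : y ≤ w := by
    have h1 : y ^ 2 < w + 1 := Nat.lt_floor_add_one _
    nlinarith
  have hw1 : 1 ≤ w := by
    have : (1 : ℝ) ≤ w := by linarith
    exact_mod_cast this
  have hlogw : Real.log N / 64 ≤ Real.log w := by
    have h1 : Real.log N = 64 * Real.log y := by rw [← hy64, Real.log_pow]; norm_num
    rw [h1]
    have := Real.log_le_log hy0 hwge
    linarith
  have hS := le_selbergSum_pairSieve (N := N) hh hw1 (le_refl (w ^ 2))
  have hcount := card_prime_pairs_le h N (z := w ^ 2) (Nat.one_le_pow _ _ hw1)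
  have hmain : (N : ℝ) / (pairSieve h N (w ^ 2)).selbergSum (w ^ 2) ≤
      4 * 64 ^ 2 * N / Real.log N ^ 2 * totientRatio h := by
    have h1 : Real.log N ^ 2 / (4 * 64 ^ 2 * totientRatio h) ≤
        (pairSieve h N (w ^ 2)).selbergSum (w ^ 2) := by
      refine le_trans ?_ hS
      calc _ = (Real.log N / 64) ^ 2 / (4 * totientRatio h) := by field_simp
        _ ≤ _ := by gcongr
    calc _ ≤ (N : ℝ) / (Real.log N ^ 2 / (4 * 64 ^ 2 * totientRatio h)) := by gcongr
      _ = _ := by field_simp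
  have herr : ((w ^ 2 : ℕ) : ℝ) + 1 + ((w ^ 2 : ℕ) : ℝ) ^ 8 ≤ 48 * N / Real.log N ^ 2 := by
    have hw1' : (1 : ℝ) ≤ w := by exact_mod_cast hw1
    have h1 : ((w ^ 2 : ℕ) : ℝ) + 1 + ((w ^ 2 : ℕ) : ℝ) ^ 8 ≤ 3 * y ^ 32 := by
      have h2 : (w : ℝ) ^ 16 ≤ y ^ 32 := by
        calc (w : ℝ) ^ 16 ≤ (y ^ 2) ^ 16 := by gcongr
          _ = _ := by ring
      have h3 : (w : ℝ) ^ 2 ≤ (w : ℝ) ^ 16 := pow_le_pow_right₀ hw1' (by norm_num)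
      have h4 : (1 : ℝ) ≤ (w : ℝ) ^ 16 := one_le_pow₀ hw1'
      push_cast
      calc _ = (w : ℝ) ^ 2 + 1 + (w : ℝ) ^ 16 := by ring
        _ ≤ _ := by linarith
    have h5 : Real.log N ≤ 4 * y ^ 16 := by
      have h6 := Real.log_le_rpow_div hN0.le (show (0 : ℝ) < 1 / 4 by norm_num)
      have h7 : (N : ℝ) ^ (1 / 4 : ℝ) = y ^ 16 := by
        rw [hy, ← Real.rpow_natCast, ← Real.rpow_mul hN0.le]; norm_num
      rw [h7] at h6
      linarith
    rw [le_div_iff₀ (by positivity)]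
    calc _ ≤ (3 * y ^ 32) * (4 * y ^ 16) ^ 2 := by gcongr
      _ = 48 * y ^ 64 := by ring
      _ = _ := by rw [hy64]
  calc _ ≤ 4 * 64 ^ 2 * N / Real.log N ^ 2 * totientRatio h +
        48 * N / Real.log N ^ 2 * totientRatio h := by
        have : 48 * N / Real.log N ^ 2 ≤ 48 * N / Real.log N ^ 2 * totientRatio h :=
          le_mul_of_one_le_right (by positivity) hG
        linarith
    _ = _ := by ring

/-! ### Differences of Fibonacci numbers and the mean of h/φ(h). -/

/-- The addition formula, with F_{n−1} written as F_{n+1} − F_n so that n = 0 is allowed. -/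
theorem Nat.cast_fib_add (m n : ℕ) : (Nat.fib (m + n) : ℤ) =
    Nat.fib m * (Nat.fib (n + 1) - Nat.fib n) + Nat.fib (m + 1) * Nat.fib n := by
  have h1 := Nat.fib_add m n
  have h2 := Nat.fib_add m (n + 1)
  have h3 : Nat.fib (m + (n + 1) + 1) = Nat.fib (m + n) + Nat.fib (m + n + 1) := Nat.fib_add_two
  have h4 : Nat.fib (n + 1 + 1) = Nat.fib n + Nat.fib (n + 1) := Nat.fib_add_two
  rw [h3, h4] at h2
  zify at h1 h2
  linear_combination h2 - h1

theorem Nat.cast_fib_cassini_even (m : ℕ) :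
    (Nat.fib (2 * m + 1) : ℤ) ^ 2 - Nat.fib (2 * m) * Nat.fib (2 * m + 1) -
      (Nat.fib (2 * m) : ℤ) ^ 2 = 1 := by
  induction m with
  | zero => simp
  | succ m ih =>
    have h1 : Nat.fib (2 * (m + 1)) = Nat.fib (2 * m) + Nat.fib (2 * m + 1) := Nat.fib_add_two
    have h2 : Nat.fib (2 * (m + 1) + 1) = Nat.fib (2 * m + 1) + Nat.fib (2 * (m + 1)) :=
      Nat.fib_add_two
    rw [h2, h1]
    push_cast
    linear_combination ih

/-- The last factor is the Lucas number L_{u+2m}. The step 4m makes the half-step 2m even, which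
fixes the sign in Cassini's identity. -/
theorem Nat.cast_fib_add_four_mul (u m : ℕ) : (Nat.fib (u + 4 * m) : ℤ) = Nat.fib u +
    Nat.fib (2 * m) * (2 * Nat.fib (u + 2 * m + 1) - Nat.fib (u + 2 * m)) := by
  have h1 := Nat.cast_fib_add u (2 * m)
  have h2 := Nat.fib_add u (2 * m)
  have h3 := Nat.cast_fib_add (u + 2 * m) (2 * m)
  have h4 := Nat.cast_fib_cassini_even m
  rw [show u + 2 * m + 2 * m = u + 4 * m by ring] at h3
  zify at h2
  rw [h3, h1, h2]
  linear_combination (Nat.fib u : ℤ) * h4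

/-- The difference equals F_{2(i−j)} L_{2(i+j)}, and F_{4(i+j)} = F_{2(i+j)} L_{2(i+j)}. -/
theorem Nat.primeFactors_fib_sub_fib_subset {i j : ℕ} (hj : 0 < j) (hij : j < i) :
    (Nat.fib (4 * i) - Nat.fib (4 * j)).primeFactors ⊆
      (Nat.fib (4 * (i + j))).primeFactors ∪ (Nat.fib (2 * (i - j))).primeFactors := by
  intro p hp
  obtain ⟨hpp, hpd, -⟩ := Nat.mem_primeFactors.1 hp
  obtain ⟨m, rfl⟩ : ∃ m, i = j + m := ⟨i - j, by omega⟩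
  have hm : 0 < m := by omega
  have h1 := Nat.cast_fib_add_four_mul (4 * j) m
  have h2 : (Nat.fib (4 * (j + m + j)) : ℤ) = Nat.fib (4 * j + 2 * m) *
      (2 * Nat.fib (4 * j + 2 * m + 1) - Nat.fib (4 * j + 2 * m)) := by
    have h3 := Nat.fib_two_mul (4 * j + 2 * m)
    rw [show 4 * (j + m + j) = 2 * (4 * j + 2 * m) by ring, h3]
    have h4 : Nat.fib (4 * j + 2 * m) ≤ 2 * Nat.fib (4 * j + 2 * m + 1) :=
      Nat.fib_le_fib_succ.trans (by omega)
    push_cast [Nat.cast_sub h4]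
    ring
  have hle : Nat.fib (4 * j) ≤ Nat.fib (4 * (j + m)) := Nat.fib_mono (by omega)
  have h5 : (p : ℤ) ∣ Nat.fib (2 * m) *
      (2 * Nat.fib (4 * j + 2 * m + 1) - Nat.fib (4 * j + 2 * m)) := by
    have h6 : ((Nat.fib (4 * (j + m)) - Nat.fib (4 * j) : ℕ) : ℤ) = Nat.fib (2 * m) *
        (2 * Nat.fib (4 * j + 2 * m + 1) - Nat.fib (4 * j + 2 * m)) := by
      rw [Nat.cast_sub hle, mul_add, h1]; ring
    rw [← h6]
    exact_mod_cast hpd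
  rw [Finset.mem_union]
  rcases (Nat.prime_iff_prime_int.1 hpp).dvd_or_dvd h5 with h7 | h7
  · right
    rw [Nat.add_sub_cancel_left]
    exact Nat.mem_primeFactors.2 ⟨hpp, by exact_mod_cast h7, (Nat.fib_pos.2 (by omega)).ne'⟩
  · left
    have h8 : (p : ℤ) ∣ Nat.fib (4 * (j + m + j)) := h2 ▸ h7.mul_left _
    exact Nat.mem_primeFactors.2 ⟨hpp, by exact_mod_cast h8, (Nat.fib_pos.2 (by omega)).ne'⟩

theorem totientRatio_le_mul {a b n : ℕ} (h : n.primeFactors ⊆ a.primeFactors ∪ b.primeFactors) :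
    totientRatio n ≤ totientRatio a * totientRatio b := by
  have h1 : ∀ s : Finset ℕ, (∀ p ∈ s, p.Prime) → 1 ≤ ∏ p ∈ s, (1 - (p : ℝ)⁻¹)⁻¹ := fun s hs =>
    calc (1 : ℝ) = ∏ _p ∈ s, 1 := by simp
      _ ≤ _ := Finset.prod_le_prod (fun _ _ => zero_le_one)
        fun _ hp => one_le_inv_one_sub_inv (hs _ hp)
  have hp : ∀ p ∈ a.primeFactors ∪ b.primeFactors, p.Prime := fun p hp => by
    rcases Finset.mem_union.1 hp with h | h <;> exact Nat.prime_of_mem_primeFactors h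
  have h2 := h1 ((a.primeFactors ∪ b.primeFactors) \ n.primeFactors)
    fun p h => hp p (Finset.mem_sdiff.1 h).1
  have h3 := h1 (a.primeFactors ∩ b.primeFactors)
    fun p h => Nat.prime_of_mem_primeFactors (Finset.mem_inter.1 h).1
  have h4 := one_le_totientRatio n
  simp only [totientRatio] at h4 ⊢
  rw [← Finset.prod_union_inter (s₁ := a.primeFactors), ← Finset.prod_sdiff h]
  have h5 : ∏ p ∈ n.primeFactors, (1 - (p : ℝ)⁻¹)⁻¹ ≤
      (∏ p ∈ (a.primeFactors ∪ b.primeFactors) \ n.primeFactors, (1 - (p : ℝ)⁻¹)⁻¹) *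
        ∏ p ∈ n.primeFactors, (1 - (p : ℝ)⁻¹)⁻¹ := le_mul_of_one_le_left (by linarith) h2
  exact h5.trans (le_mul_of_one_le_right (by linarith) h3)

theorem totientRatio_sq_le (n : ℕ) :
    totientRatio n ^ 2 ≤ ∏ p ∈ n.primeFactors, (1 + 6 / (p : ℝ)) := by
  rw [totientRatio, ← Finset.prod_pow]
  apply Finset.prod_le_prod
  · intros; positivity
  · intro p hp
    have h2 : (2 : ℝ) ≤ p := by exact_mod_cast (Nat.prime_of_mem_primeFactors hp).two_le
    have hx0 : 0 < (p : ℝ)⁻¹ := by positivity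
    have hx : (p : ℝ)⁻¹ ≤ 2⁻¹ := by gcongr
    rw [div_eq_mul_inv]
    set x := (p : ℝ)⁻¹
    rw [inv_pow, inv_le_iff_one_le_mul₀ (by nlinarith)]
    -- (1 + 6x)(1 − x)² − 1 = x(1 − 2x)(4 − 3x); the constant 6 gives equality at p = 2.
    nlinarith [mul_nonneg hx0.le (mul_nonneg (show 0 ≤ 1 - 2 * x by linarith)
      (show 0 ≤ 4 - 3 * x by linarith))]

theorem exists_sum_totientRatio_sq_fib_le : ∃ D : ℝ, 0 < D ∧ ∀ (X : ℕ) (T : Finset ℕ) (g : ℕ → ℕ),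
    Set.InjOn g T → (∀ j ∈ T, 1 ≤ g j ∧ g j ≤ X) →
      ∑ j ∈ T, totientRatio (Nat.fib (g j)) ^ 2 ≤ D * X := by
  obtain ⟨D, hD0, hD⟩ := exists_sum_prod_primeFactors_fib_le (show (0 : ℝ) < 6 by norm_num)
  refine ⟨D, hD0, fun X T g hg hX => ?_⟩
  calc _ = ∑ n ∈ T.image g, totientRatio (Nat.fib n) ^ 2 := (Finset.sum_image hg).symm
    _ ≤ ∑ n ∈ Finset.Icc 1 X, totientRatio (Nat.fib n) ^ 2 := by
        apply Finset.sum_le_sum_of_subset_of_nonneg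
        · intro n hn
          obtain ⟨j, hj, rfl⟩ := Finset.mem_image.1 hn
          exact Finset.mem_Icc.2 (hX j hj)
        · intros; positivity
    _ ≤ _ := (Finset.sum_le_sum fun n _ => totientRatio_sq_le _).trans (hD X)

/-- For fixed i, the maps j ↦ 4(i + j) and j ↦ 2(i − j) are injective into [1, 8K], and ab ≤ (a² +
b²)/2 separates the two ratios. -/
theorem exists_sum_totientRatio_fib_sub_fib_le : ∃ D : ℝ, 0 < D ∧ ∀ K : ℕ,
    (∑ i ∈ Finset.Icc 1 K, ∑ j ∈ Finset.Icc 1 K with j < i,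
      totientRatio (Nat.fib (4 * i) - Nat.fib (4 * j))) ≤ D * K ^ 2 := by
  obtain ⟨D, hD0, hD⟩ := exists_sum_totientRatio_sq_fib_le
  refine ⟨8 * D, by positivity, fun K => ?_⟩
  have h1 : ∀ i ∈ Finset.Icc 1 K, ∑ j ∈ Finset.Icc 1 K with j < i,
      totientRatio (Nat.fib (4 * i) - Nat.fib (4 * j)) ≤ 8 * D * K := by
    intro i hi
    have hiK := Finset.mem_Icc.1 hi
    have ha := hD (8 * K) ((Finset.Icc 1 K).filter (· < i)) (fun j => 4 * (i + j))
      (fun a _ b _ hab => by simp only at hab; omega)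
      (fun j hj => by simp only [Finset.mem_filter, Finset.mem_Icc] at hj; omega)
    have hb := hD (8 * K) ((Finset.Icc 1 K).filter (· < i)) (fun j => 2 * (i - j))
      (fun a ha b hb hab => by
        simp only [Finset.coe_filter, Finset.mem_Icc, Set.mem_ofPred_eq] at hab ha hb; omega)
      (fun j hj => by simp only [Finset.mem_filter, Finset.mem_Icc] at hj; omega)
    calc _ ≤ ∑ j ∈ Finset.Icc 1 K with j < i, (totientRatio (Nat.fib (4 * (i + j))) ^ 2 / 2 +
          totientRatio (Nat.fib (2 * (i - j))) ^ 2 / 2) := by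
          apply Finset.sum_le_sum
          intro j hj
          simp only [Finset.mem_filter, Finset.mem_Icc] at hj
          have := totientRatio_le_mul (Nat.primeFactors_fib_sub_fib_subset hj.1.1 hj.2)
          nlinarith [sq_nonneg (totientRatio (Nat.fib (4 * (i + j))) -
            totientRatio (Nat.fib (2 * (i - j))))]
      _ ≤ _ := by
          rw [Finset.sum_add_distrib, ← Finset.sum_div, ← Finset.sum_div]
          push_cast at ha hb
          linarith
  calc _ ≤ ∑ i ∈ Finset.Icc 1 K, 8 * D * K := Finset.sum_le_sum h1
    _ = _ := by simp; ring

/-! ### Cauchy–Schwarz and the count of collisions. -/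

theorem Finset.card_sq_le_card_image_mul_card_filter {α : Type*} (s : Finset α) (f : α → ℕ) :
    s.card ^ 2 ≤ (s.image f).card * ((s ×ˢ s).filter fun x => f x.1 = f x.2).card := by
  classical
  have h1 : s.card = ∑ b ∈ s.image f, (s.filter fun a => f a = b).card :=
    Finset.card_eq_sum_card_image f s
  have h2 : ((s ×ˢ s).filter fun x => f x.1 = f x.2).card =
      ∑ b ∈ s.image f, (s.filter fun a => f a = b).card ^ 2 := by
    rw [Finset.card_eq_sum_card_fiberwise (f := fun x => f x.1) (t := s.image f)]
    · apply Finset.sum_congr rfl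
      intro b _
      rw [sq, ← Finset.card_product]
      congr 1
      ext ⟨x, y⟩
      simp only [Finset.mem_filter, Finset.mem_product]
      constructor
      · rintro ⟨⟨⟨hx, hy⟩, hxy⟩, rfl⟩
        exact ⟨⟨hx, rfl⟩, hy, hxy.symm⟩
      · rintro ⟨⟨hx, rfl⟩, hy, hxy⟩
        exact ⟨⟨⟨hx, hy⟩, hxy.symm⟩, rfl⟩
    · intro x hx
      simp only [Finset.coe_filter, Finset.mem_product, Set.mem_ofPred_eq] at hx
      exact Finset.mem_image_of_mem f hx.1.1
  rw [h2]
  nth_rewrite 1 [h1]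
  exact sq_sum_le_card_mul_sum_sq

/-- Collisions with i = j are trivial. For j < i the triple (i, j, p) determines q = p + (a i − a
j), and swapping the two pairs covers i < j. -/
theorem card_filter_add_eq_add_le (Q : Finset ℕ) {a : ℕ → ℕ} (ha : StrictMono a) (K : ℕ) :
    (((Q ×ˢ Finset.Icc 1 K) ×ˢ (Q ×ˢ Finset.Icc 1 K)).filter
      fun x => x.1.1 + a x.1.2 = x.2.1 + a x.2.2).card ≤
    (Q ×ˢ Finset.Icc 1 K).card + 2 * ∑ i ∈ Finset.Icc 1 K, ∑ j ∈ Finset.Icc 1 K with j < i,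
      (Q.filter fun p => p + (a i - a j) ∈ Q).card := by
  set s := Q ×ˢ Finset.Icc 1 K
  set E := (s ×ˢ s).filter fun x => x.1.1 + a x.1.2 = x.2.1 + a x.2.2 with hE
  have hmemE : ∀ x, x ∈ E ↔ (x.1 ∈ s ∧ x.2 ∈ s) ∧ x.1.1 + a x.1.2 = x.2.1 + a x.2.2 := by
    intro x; simp [hE]
  have hdiag : (E.filter fun x => x.1.2 = x.2.2).card ≤ s.card := by
    apply Finset.card_le_card_of_injOn Prod.fst
    · intro x hx
      exact ((hmemE x).1 (Finset.mem_filter.1 hx).1).1.1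
    · rintro ⟨⟨p, i⟩, ⟨q, j⟩⟩ hx ⟨⟨p', i'⟩, ⟨q', j'⟩⟩ hx' heq
      simp only [Finset.coe_filter, Set.mem_ofPred_eq, hmemE] at hx hx'
      simp only [Prod.mk.injEq] at heq ⊢
      obtain ⟨rfl, rfl⟩ := heq
      obtain ⟨⟨_, h1⟩, rfl⟩ := hx
      obtain ⟨⟨_, h2⟩, rfl⟩ := hx'
      omega
  have hlt : (E.filter fun x => x.2.2 < x.1.2).card ≤
      ∑ i ∈ Finset.Icc 1 K, ∑ j ∈ Finset.Icc 1 K with j < i,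
        (Q.filter fun p => p + (a i - a j) ∈ Q).card := by
    simp only [← Finset.card_sigma]
    apply Finset.card_le_card_of_injOn
      (fun x : (ℕ × ℕ) × (ℕ × ℕ) => (⟨x.1.2, ⟨x.2.2, x.1.1⟩⟩ : (_ : ℕ) × (_ : ℕ) × ℕ))
    · rintro ⟨⟨p, i⟩, ⟨q, j⟩⟩ hx
      simp only [Finset.coe_filter, Set.mem_ofPred_eq, hmemE, s, Finset.mem_product] at hx
      obtain ⟨⟨⟨⟨hp, hi⟩, hq, hj⟩, h1⟩, h2⟩ := hx
      simp only [Finset.mem_coe, Finset.mem_sigma, Finset.mem_filter]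
      refine ⟨hi, ⟨hj, h2⟩, hp, ?_⟩
      have h3 := ha h2
      have : p + (a i - a j) = q := by omega
      rwa [this]
    · rintro ⟨⟨p, i⟩, ⟨q, j⟩⟩ hx ⟨⟨p', i'⟩, ⟨q', j'⟩⟩ hx' heq
      simp only [Finset.coe_filter, Set.mem_ofPred_eq, hmemE] at hx hx'
      simp only [Sigma.mk.injEq, heq_eq_eq] at heq
      obtain ⟨rfl, rfl, rfl⟩ := heq
      have h1 := hx.1.2
      have h2 := hx'.1.2
      simp only [Prod.mk.injEq, and_true, true_and]
      omega
  have hgt : (E.filter fun x => x.1.2 < x.2.2).card ≤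
      (E.filter fun x => x.2.2 < x.1.2).card := by
    apply Finset.card_le_card_of_injOn Prod.swap
    · intro x hx
      simp only [Finset.coe_filter, Set.mem_ofPred_eq, hmemE] at hx ⊢
      exact ⟨⟨hx.1.1.symm, hx.1.2.symm⟩, hx.2⟩
    · exact Prod.swap_injective.injOn
  have hcover : E ⊆ (E.filter fun x => x.1.2 = x.2.2) ∪
      ((E.filter fun x => x.2.2 < x.1.2) ∪ (E.filter fun x => x.1.2 < x.2.2)) := by
    intro x hx
    simp only [Finset.mem_union, Finset.mem_filter, hx, true_and]
    omega
  have h1 := Finset.card_le_card hcover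
  have h2 := Finset.card_union_le (E.filter fun x => x.1.2 = x.2.2)
      ((E.filter fun x => x.2.2 < x.1.2) ∪ (E.filter fun x => x.1.2 < x.2.2))
  have h3 := Finset.card_union_le (E.filter fun x => x.2.2 < x.1.2)
    (E.filter fun x => x.1.2 < x.2.2)
  omega

theorem div_le_primeCounting_half_mul_log {N : ℕ} (hN : 24 ≤ N) :
    (N : ℝ) / 8 ≤ (Nat.primesLE (N / 2)).card * Real.log N := by
  set M := N / 2 with hM
  have hM1 : (N : ℝ) - 1 ≤ 2 * M := by
    have : N ≤ 2 * M + 1 := by omega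
    have : (N : ℝ) ≤ 2 * M + 1 := by exact_mod_cast this
    linarith
  have hN' : (24 : ℝ) ≤ N := by exact_mod_cast hN
  have hMpos : (0 : ℝ) < M := by linarith
  have h1 := (Chebyshev.psi_ge M).trans (Chebyshev.psi_le_primeCounting_mul_log M)
  rw [← Nat.primesLE_card_eq_primeCounting] at h1
  -- The tangent of log at 8: its slope is small enough for the linear main term to absorb it.
  have h2 : Real.log (M + 1) ≤ (M + 1) / 8 + 2 := by
    have h3 := Real.log_le_sub_one_of_pos (show (0 : ℝ) < (M + 1) / 8 by positivity)
    rw [Real.log_div (by positivity) (by norm_num), show (8 : ℝ) = 2 ^ 3 by norm_num,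
      Real.log_pow] at h3
    have := Real.log_two_lt_d9
    push_cast at h3
    linarith
  have h4 : Real.log M ≤ Real.log N := Real.log_le_log hMpos (by exact_mod_cast Nat.div_le_self N 2)
  have h5 : ((Nat.primesLE M).card : ℝ) * Real.log M ≤ (Nat.primesLE M).card * Real.log N := by
    gcongr
  have h6 := Real.log_two_gt_d9
  nlinarith

theorem strictMono_fib_four_mul : StrictMono fun i => Nat.fib (4 * i) := by
  apply strictMono_nat_of_lt_succ
  intro i
  rcases Nat.eq_zero_or_pos i with rfl | hi
  · decide
  · exact (Nat.fib_lt_fib_succ (by omega)).trans_le (Nat.fib_mono (by omega))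

theorem exists_mul_le_card_prime_add_fib : ∃ c : ℝ, 0 < c ∧ ∃ N₀ : ℕ, ∀ N : ℕ, N₀ ≤ N →
    c * N ≤ ((Nat.primesLE (N / 2) ×ˢ Finset.Icc 1 (Nat.log 2 N / 8)).image
      fun x => x.1 + Nat.fib (4 * x.2)).card := by
  obtain ⟨C, hC0, N₀, hC⟩ := exists_card_prime_pairs_le
  obtain ⟨D, hD0, hD⟩ := exists_sum_totientRatio_fib_sub_fib_le
  -- There are at least N/128 pairs (8 from Chebyshev, 16 from log N ≤ 16K), and collisions number
  -- at most 1 + 2·128·CD times the pairs. The threshold 2^8 ensures K ≥ 1.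
  refine ⟨(128 * (1 + 256 * C * D))⁻¹, by positivity, max N₀ (2 ^ 8), fun N hN => ?_⟩
  have hN256 : 2 ^ 8 ≤ N := (le_max_right _ _).trans hN
  have hN0 : (0 : ℝ) < N := by
    have : 0 < N := by omega
    exact_mod_cast this
  have hlog : 0 < Real.log N := Real.log_pos (by
    have : 1 < N := by omega
    exact_mod_cast this)
  set K := Nat.log 2 N / 8 with hK
  set Q := Nat.primesLE (N / 2) with hQ
  have hK1 : 1 ≤ K := by
    have : 8 ≤ Nat.log 2 N := Nat.le_log_of_pow_le one_lt_two hN256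
    omega
  have hKle : (K : ℝ) ≤ Real.log N := by
    have h1 : 2 ^ (8 * K) ≤ N :=
      (Nat.pow_le_pow_right (by norm_num) (Nat.mul_div_le _ 8)).trans
        (Nat.pow_log_le_self 2 (by omega))
    have h2 : ((8 * K : ℕ) : ℝ) * Real.log 2 ≤ Real.log N := by
      rw [← Real.log_pow]
      exact Real.log_le_log (by positivity) (by exact_mod_cast h1)
    have h3 := Real.log_two_gt_d9
    have h4 : (0 : ℝ) ≤ K := Nat.cast_nonneg K
    push_cast at h2
    nlinarith
  have hKge : Real.log N ≤ 16 * K := by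
    have h1 : N < 2 ^ (16 * K) :=
      (Nat.lt_pow_succ_log_self one_lt_two N).trans_le
        (Nat.pow_le_pow_right (by norm_num) (by omega))
    have h2 : Real.log N ≤ ((16 * K : ℕ) : ℝ) * Real.log 2 := by
      rw [← Real.log_pow]
      exact Real.log_le_log hN0 (by exact_mod_cast h1.le)
    have h3 := Real.log_two_lt_d9
    have h4 : (0 : ℝ) ≤ K := Nat.cast_nonneg K
    push_cast at h2
    nlinarith
  set s := Q ×ˢ Finset.Icc 1 K with hs
  have hcard : (s.card : ℝ) = Q.card * K := by simp [hs]
  have hslow : (N : ℝ) / 128 ≤ s.card := by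
    have h1 := div_le_primeCounting_half_mul_log (N := N) (by omega)
    rw [hcard]
    have h2 : ((Nat.primesLE (N / 2)).card : ℝ) * Real.log N ≤ Q.card * (16 * K) := by
      gcongr
    linarith
  have hspos : (0 : ℝ) < s.card := lt_of_lt_of_le (by positivity) hslow
  have hpairs : ((∑ i ∈ Finset.Icc 1 K, ∑ j ∈ Finset.Icc 1 K with j < i,
      (Q.filter fun p => p + (Nat.fib (4 * i) - Nat.fib (4 * j)) ∈ Q).card : ℕ) : ℝ) ≤
      C * D * N := by
    push_cast
    calc _ ≤ ∑ i ∈ Finset.Icc 1 K, ∑ j ∈ Finset.Icc 1 K with j < i,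
          C * N / Real.log N ^ 2 * totientRatio (Nat.fib (4 * i) - Nat.fib (4 * j)) := by
          apply Finset.sum_le_sum
          intro i _
          apply Finset.sum_le_sum
          intro j hj
          have hji := strictMono_fib_four_mul (Finset.mem_filter.1 hj).2
          refine le_trans ?_ (hC N ((le_max_left _ _).trans hN) _ (Nat.sub_ne_zero_of_lt hji))
          norm_cast
          apply Finset.card_le_card
          intro p hp
          rw [Finset.mem_filter, hQ, Nat.mem_primesLE, Nat.mem_primesLE] at hp
          rw [Finset.mem_filter, Finset.mem_range]
          exact ⟨by omega, hp.1.2, hp.2.2⟩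
      _ = C * N / Real.log N ^ 2 * ∑ i ∈ Finset.Icc 1 K, ∑ j ∈ Finset.Icc 1 K with j < i,
          totientRatio (Nat.fib (4 * i) - Nat.fib (4 * j)) := by simp only [Finset.mul_sum]
      _ ≤ C * N / Real.log N ^ 2 * (D * K ^ 2) := by gcongr; exact hD K
      _ ≤ C * N / Real.log N ^ 2 * (D * Real.log N ^ 2) := by gcongr
      _ = _ := by field_simp
  have henergy := card_filter_add_eq_add_le Q strictMono_fib_four_mul K
  have hcs := Finset.card_sq_le_card_image_mul_card_filter s fun x => x.1 + Nat.fib (4 * x.2)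
  set E := ((s ×ˢ s).filter fun x => x.1.1 + Nat.fib (4 * x.1.2) =
    x.2.1 + Nat.fib (4 * x.2.2)).card
  set V := (s.image fun x => x.1 + Nat.fib (4 * x.2)).card
  have hEle : (E : ℝ) ≤ (1 + 256 * C * D) * s.card := by
    have h1 : (E : ℝ) ≤ s.card + 2 * (C * D * N) := by
      have h2 : (E : ℝ) ≤ s.card + 2 * ((∑ i ∈ Finset.Icc 1 K, ∑ j ∈ Finset.Icc 1 K with j < i,
          (Q.filter fun p => p + (Nat.fib (4 * i) - Nat.fib (4 * j)) ∈ Q).card : ℕ) : ℝ) := by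
        exact_mod_cast henergy
      linarith
    have h3 : C * D * N ≤ C * D * (128 * s.card) := by
      gcongr
      linarith
    linarith
  have hcs' : (s.card : ℝ) ^ 2 ≤ V * E := by exact_mod_cast hcs
  have h4 : (s.card : ℝ) * s.card ≤ (V * (1 + 256 * C * D)) * s.card := by
    calc (s.card : ℝ) * s.card = (s.card : ℝ) ^ 2 := by ring
      _ ≤ V * E := hcs'
      _ ≤ V * ((1 + 256 * C * D) * s.card) := by gcongr
      _ = _ := by ring
  have h5 := le_of_mul_le_mul_right h4 hspos
  rw [inv_mul_le_iff₀ (by positivity)]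
  linarith

theorem fib_four_mul_le_half {N i : ℕ} (hi : 1 ≤ i) (hiN : i ≤ Nat.log 2 N / 8) :
    Nat.fib (4 * i) ≤ N / 2 := by
  have hN : N ≠ 0 := by rintro rfl; simp at hiN; omega
  have h1 : 2 ^ (4 * i + 1) ≤ N :=
    (Nat.pow_le_pow_right (by norm_num) (by omega)).trans (Nat.pow_log_le_self 2 hN)
  have h2 := Nat.fib_le_two_pow (4 * i)
  rw [pow_succ] at h1
  omega

/-! ### Counting functions, lower density and k-fold sums. -/

theorem finite_countingFn_set (S : Set ℕ) (N : ℕ) : {n : ℕ | n ∈ S ∧ 1 ≤ n ∧ n ≤ N}.Finite :=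
  (Set.finite_Icc 1 N).subset fun _ hn => hn.2

theorem countingFn_le (S : Set ℕ) (N : ℕ) : countingFn S N ≤ N := by
  have h := Set.ncard_le_ncard (show {n : ℕ | n ∈ S ∧ 1 ≤ n ∧ n ≤ N} ⊆ (Finset.Icc 1 N : Set ℕ) from
    fun n hn => by simpa using hn.2) (Finset.finite_toSet _)
  rw [Set.ncard_coe_finset] at h
  simpa [countingFn] using h

theorem countingFn_le_of_add_mem {S T : Set ℕ} {m : ℕ} (h : ∀ n ∈ S, n + m ∈ T) (N : ℕ) :
    countingFn S N ≤ countingFn T (N + m) := by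
  refine Set.ncard_le_ncard_of_injOn (· + m) ?_ ?_ (finite_countingFn_set T (N + m))
  · intro n hn
    exact ⟨h n hn.1, by have := hn.2; omega, by have := hn.2; omega⟩
  · intro a _ b _ hab
    simpa using hab

theorem lowerAsymptoticDensity_pos {S : Set ℕ} {c : ℝ} (hc : 0 < c) {N₀ : ℕ}
    (h : ∀ N : ℕ, N₀ ≤ N → c * N ≤ countingFn S N) : 0 < lowerAsymptoticDensity S := by
  refine hc.trans_le (Filter.le_liminf_of_le ?_ ?_)
  -- A real `liminf` is meaningful here only because the quotients are bounded above, by 1.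
  · refine Filter.IsBoundedUnder.isCoboundedUnder_ge ⟨1, ?_⟩
    rw [Filter.eventually_map]
    filter_upwards with N
    exact div_le_one_of_le₀ (by exact_mod_cast countingFn_le S N) (Nat.cast_nonneg N)
  · filter_upwards [Filter.eventually_ge_atTop (max N₀ 1)] with N hN
    have hN1 : (0 : ℝ) < N := by exact_mod_cast (le_max_right _ _).trans hN
    rw [le_div_iff₀ hN1]
    exact h N ((le_max_left _ _).trans hN)

theorem exists_mul_le_countingFn_primeSet_add_fibSet :
    ∃ c : ℝ, 0 < c ∧ ∃ N₀ : ℕ, ∀ N : ℕ, N₀ ≤ N →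
    c * (N : ℝ) ≤ (countingFn (primeSet + fibSet) N : ℝ) := by
  obtain ⟨c, hc, N₀, h⟩ := exists_mul_le_card_prime_add_fib
  refine ⟨c, hc, N₀, fun N hN => (h N hN).trans ?_⟩
  norm_cast
  rw [← Set.ncard_coe_finset]
  apply Set.ncard_le_ncard _ (finite_countingFn_set _ N)
  intro n hn
  simp only [Finset.coe_image, Set.mem_image, Finset.mem_coe, Finset.mem_product,
    Nat.mem_primesLE, Finset.mem_Icc] at hn
  obtain ⟨⟨p, i⟩, ⟨⟨hpN, hp⟩, hi1, hi⟩, rfl⟩ := hn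
  have h1 := fib_four_mul_le_half hi1 hi
  have h2 := hp.one_lt
  refine ⟨Set.add_mem_add hp ⟨4 * i, by omega, rfl⟩, ?_, ?_⟩ <;> dsimp only at * <;> omega

theorem one_mem_fibSet : 1 ∈ fibSet := ⟨2, le_rfl, rfl⟩

theorem add_mem_foldSumset {v : ℕ} (hv : v ∈ fibSet) (k : ℕ) :
    v + k ∈ foldSumset (k + 1) fibSet := by
  refine ⟨Fin.cons v fun _ => 1, fun i => ?_, by simp [Fin.sum_univ_succ]⟩
  refine Fin.cases ?_ (fun j => ?_) i
  · simpa using hv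
  · simpa using one_mem_fibSet

theorem theorem1 :
    (∃ c : ℝ, 0 < c ∧ ∃ N₀ : ℕ, ∀ N : ℕ, N₀ ≤ N →
      c * (N : ℝ) ≤ (countingFn (primeSet + fibSet) N : ℝ)) ∧
    0 < lowerAsymptoticDensity (primeSet + fibSet) ∧
    ∀ k : ℕ, 1 ≤ k → 0 < lowerAsymptoticDensity (primeSet + foldSumset k fibSet) := by
  obtain ⟨c, hc, N₀, h⟩ := exists_mul_le_countingFn_primeSet_add_fibSet
  refine ⟨⟨c, hc, N₀, h⟩, lowerAsymptoticDensity_pos hc h, fun k hk => ?_⟩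
  obtain ⟨k, rfl⟩ : ∃ m, k = m + 1 := ⟨k - 1, by omega⟩
  have hshift : ∀ n ∈ primeSet + fibSet, n + k ∈ primeSet + foldSumset (k + 1) fibSet := by
    rintro _ ⟨p, hp, v, hv, rfl⟩
    exact ⟨p, hp, v + k, add_mem_foldSumset hv k, (add_assoc p v k).symm⟩
  -- With M = N − k, the threshold gives M ≥ N₀ and M ≥ k, hence M ≥ N/2: the shift costs at most
  -- half of c.
  refine lowerAsymptoticDensity_pos (half_pos hc) (N₀ := N₀ + 2 * k) fun N hN => ?_
  obtain ⟨M, rfl⟩ : ∃ M, N = M + k := ⟨N - k, by omega⟩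
  have h1 := h M (by omega)
  have h2 : (countingFn (primeSet + fibSet) M : ℝ) ≤
      countingFn (primeSet + foldSumset (k + 1) fibSet) (M + k) := by
    exact_mod_cast countingFn_le_of_add_mem hshift M
  have h3 : (k : ℝ) ≤ M := by
    have : k ≤ M := by omega
    exact_mod_cast this
  refine le_trans ?_ (h1.trans h2)
  push_cast
  nlinarith
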